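/- **Notation.** A convex body is a non-empty compact convex subset of $\mathbb R^n$; $\mathrm{vol}$ is Lebesgue measure, $B_2^n$ the closed Euclidean unit ball and $\kappa_i=\mathrm{vol}(B_2^i)$. The relative quermassintegrals $W_i(K;E)$ of convex bodies $K,E\subset\mathbb R^n$ are the numbers with $\mathrm{vol}(K+\lambda E)=\sum_{i=0}^n\binom ni W_i(K;E)\lambda^i$ for all $\lambda\ge 0$. The intrinsic volumes of $K$ are $V_i(K)=\frac{\binom ni}{\kappa_{n-i}}W_{n-i}(K;B_2^n)$, $0\le i\le n$, and the Wills functional is $\mathcal W(K)=\sum_{i=0}^nV_i(K)$. The measure $\gamma_n$ on $\mathbb R^n$ is the standard Gaussian, $d\gamma_n(x)=(2\pi)^{-n/2}e^{-|x|^2/2}dx$. Let $E$ be a convex body with $0\in\mathrm{int}\,E$, let $|x|_E=\min\{\lambda\ge 0:x\in\lambda E\}$ and $d_E(x,K)=\min_{y\in K}|x-y|_E$. Let $u:[0,\infty)\to\mathbb R\cup\{\infty\}$ be convex, increasing, and continuous on $\{u\neq\infty\}$. Suppose that $u$ is strictly increasing on $\{u\ne\infty\}$ and that $u(t)<\infty$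 for some $t>0$ (both hold if $u$ is strictly increasing on $[0,\infty)$). Put $u^{-1}(s)=\sup\{t\ge 0:u(t)\le s\}$ for $s\ge u(0)$ and $$\mathcal W_u(K;E)=\int_{\mathbb R^n}e^{-u(d_E(x,K))}dx,\qquad m_i^u=\int_{u(0)}^\infty u^{-1}(s)^ie^{-s}\,ds,\qquad d\mu_{u,E}(x)=e^{-u(|x|_E)}dx .$$ **Theorem.** (a) For every convex body $K\subset\mathbb R^n$ with non-empty interior, $$\bigl(8^{n/2}\,\mathrm{vol}(K)\bigr)^{1/2}\le\mathcal W(K)\le\frac{8^{n/2}\,\mathrm{vol}(K)}{\sup_{y\in\mathbb R^n}\gamma_n\bigl(y+\sqrt{2\pi}K\bigr)}.$$ (b) For every convex body $K\subset\mathbb R^n$ with non-empty interior and all $E$ and $u$ as above, $$\mathcal W_u(K;E)\le\min\Bigl\{\tbinom{2n}{n}e^{-u(0)}m_n^u,\;4^nm_n^{2u}\Bigr\}\,\frac{\mathrm{vol}(K)\,\mathrm{vol}(E)}{\sup_{y\in\mathbb R^n}\mu_{u,E}(y-K)}.$$ (c) For every convex body $K\subset\mathbb R^n$ with non-empty interior,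 $$\mathcal W(K)\le\frac{C_n\,\mathrm{vol}(K)}{\sup_{y\in\mathbb R^n}\gamma_n\bigl(y+\sqrt{2\pi}K\bigr)},\qquad C_n=\min\Bigl\{\tbinom{2n}{n},8^{n/2}\Bigr\},$$ where $C_2=6$, $C_3=20$ and $C_n=8^{n/2}$ for all $n\ge4$. -/

import Mathlib

open MeasureTheory Set
open scoped Pointwise ENNReal Polynomial

noncomputable section

namespace Wills

/-- `κ_i`, the volume of the Euclidean unit ball of `ℝ^i`. -/
def kappa (i : ℕ) : ℝ :=
  volume.real (Metric.closedBall (0 : EuclideanSpace ℝ (Fin i)) 1)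

/-- `p` is the Steiner polynomial of `K` relative to `E`: a polynomial of degree at most `n`
with `vol (K + t E) = p t` for all `t ≥ 0`. -/
def IsSteinerPolynomial {n : ℕ} (K E : Set (EuclideanSpace ℝ (Fin n))) (p : ℝ[X]) : Prop :=
  p.natDegree ≤ n ∧ ∀ t : ℝ, 0 ≤ t → volume.real (K + t • E) = p.eval t

open Classical in
/-- The relative quermassintegral `W_i(K; E)`: the Steiner polynomial is
`∑ i, (n choose i) W_i(K; E) t ^ i`. The value `0` stands in when there is no Steiner polynomial,
which does not happen for convex bodies. -/
def quermassintegral {n : ℕ} (K E : Set (EuclideanSpace ℝ (Fin n))) (i : ℕ) : ℝ :=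
  if h : ∃ p : ℝ[X], IsSteinerPolynomial K E p then h.choose.coeff i / (n.choose i : ℝ) else 0

/-- The quermassintegrals do not depend on a choice: there is at most one Steiner polynomial. -/
theorem quermassintegral_eq {n : ℕ} {K E : Set (EuclideanSpace ℝ (Fin n))} {p : ℝ[X]}
    (hp : IsSteinerPolynomial K E p) (i : ℕ) :
    quermassintegral K E i = p.coeff i / (n.choose i : ℝ) := by
  have h : ∃ p : ℝ[X], IsSteinerPolynomial K E p := ⟨p, hp⟩
  have hq : h.choose = p := by
    refine Polynomial.eq_of_infinite_eval_eq _ _ ((Set.Ici_infinite (0 : ℝ)).mono ?_)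
    intro t ht
    exact (h.choose_spec.2 t ht).symm.trans (hp.2 t ht)
  rw [quermassintegral, dif_pos h, hq]

/-- The intrinsic volume `V_i(K) = (n choose i) / κ_{n-i} * W_{n-i}(K)` (for `i ≤ n`), where
`W_j(K) = W_j(K; B)` with `B` the Euclidean unit ball. -/
def intrinsicVolume {n : ℕ} (K : Set (EuclideanSpace ℝ (Fin n))) (i : ℕ) : ℝ :=
  (n.choose i : ℝ) / kappa (n - i) * quermassintegral K (Metric.closedBall 0 1) (n - i)

/-- The Wills functional: the sum of the intrinsic volumes. -/
def wills {n : ℕ} (K : Set (EuclideanSpace ℝ (Fin n))) : ℝ :=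
  ∑ i ∈ Finset.range (n + 1), intrinsicVolume K i

/-- The standard Gaussian measure on `ℝ^n`,
with density `(2π)^(-n/2) exp (-|x|^2 / 2)`. -/
def gaussian (n : ℕ) : Measure (EuclideanSpace ℝ (Fin n)) :=
  volume.withDensity fun x =>
    ENNReal.ofReal (1 / (2 * Real.pi) ^ ((n : ℝ) / 2) * Real.exp (-‖x‖ ^ 2 / 2))

/-- Convex, increasing functions `u : [0, ∞) → ℝ ∪ {∞}` that are continuous on `{u ≠ ∞}`.
Values of `u` at negative arguments play no role. -/
structure IsConvexIncreasing (u : ℝ → EReal) : Prop where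
  ne_bot : ∀ t, 0 ≤ t → u t ≠ ⊥
  convex : ∀ s t a b : ℝ, 0 ≤ s → 0 ≤ t → 0 ≤ a → 0 ≤ b → a + b = 1 →
    u (a * s + b * t) ≤ (a : EReal) * u s + (b : EReal) * u t
  continuousOn : ContinuousOn u {t | 0 ≤ t ∧ u t ≠ ⊤}
  monotoneOn : MonotoneOn u (Ici 0)

/-- Strict increase of `u` where it is finite, the set `{u ≠ ∞}` being neither empty nor `{0}`.
A function that is strictly increasing on all of `[0, ∞)` is finite there and is included. -/
structure IsStrictlyIncreasing (u : ℝ → EReal) : Prop where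
  strictMonoOn : StrictMonoOn u {t | 0 ≤ t ∧ u t ≠ ⊤}
  exists_pos : ∃ t, 0 < t ∧ u t ≠ ⊤

/-- The inverse `u⁻¹(s)` for `s ≥ u 0`, as the largest `t ≥ 0` with `u t ≤ s`
(the supremum of these `t`, should `u` jump to `∞`). -/
def inverse (u : ℝ → EReal) (s : ℝ) : ℝ :=
  sSup {t : ℝ | 0 ≤ t ∧ u t ≤ (s : EReal)}

/-- `m_i^u = ∫_{u(0)}^∞ u⁻¹(s)^i e^{-s} ds`. -/
def moment (u : ℝ → EReal) (i : ℕ) : ℝ≥0∞ :=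
  ∫⁻ s in {s : ℝ | u 0 ≤ (s : EReal)}, ENNReal.ofReal (inverse u s ^ i * Real.exp (-s))

/-- The relative distance `d_E(x, K) = min_{y ∈ K} |x - y|_E`, with `|·|_E` the Minkowski
functional of `E`. -/
def relDist {n : ℕ} (E : Set (EuclideanSpace ℝ (Fin n))) (x : EuclideanSpace ℝ (Fin n))
    (K : Set (EuclideanSpace ℝ (Fin n))) : ℝ :=
  sInf ((fun y => gauge E (x - y)) '' K)

/-- The generalized Wills functional `W_u(K; E) = ∫ exp (-u (d_E(x, K))) dx`. -/
def genWills {n : ℕ} (u : ℝ → EReal) (K E : Set (EuclideanSpace ℝ (Fin n))) : ℝ≥0∞ :=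
  ∫⁻ x, EReal.exp (-u (relDist E x K))

/-- The measure `μ_{u,E}` on `ℝ^n` with density `exp (-u (|x|_E))`. -/
def gaugeMeasure {n : ℕ} (u : ℝ → EReal) (E : Set (EuclideanSpace ℝ (Fin n))) :
    Measure (EuclideanSpace ℝ (Fin n)) :=
  volume.withDensity fun x => EReal.exp (-u (gauge E x))

end Wills

end

/-! Both upper bounds control the product of `genWills u K E` with the mass `gaugeMeasure u E ({y} -
K)`, uniformly in `y`; dividing by the supremum comes last.

For the bound with the binomial coefficient, the layer-cake formula `lintegral_exp_neg` writes each
factor as an integral against `exp (-s)` of the volume of a set growing with `s`. Chebyshev's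
association inequality merges the two integrals at the cost of `exp (-u 0)`. At each level `s`, with
`L` the sublevel set of `u (gauge E ·)`, the sublevel set of the distance lies in `K + L`, so the
Rogers–Shephard inequality bounds the product of volumes by the binomial coefficient times `vol K *
vol L`. Integrating `vol L` gives the moment times `vol E`.

For the bound with `4 ^ n`, convexity of `u` and of the gauge gives `exp (-u |w|) * exp (-u |z|) ≤
exp (-2 u |(w + z) / 2|)`. Integrating over `z` and then over `x`, each halving costs a factor `2 ^
n`, and Tonelli separates `vol K` from the moment of `2 u`.

The classical functional is the case `u t = π t ^ 2` with the Euclidean ball: Hadwiger's formula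
`genWills_sqProfile` follows from the Steiner formula and Gamma integrals. The Steiner formula comes
from the nearest-point map `p`: for `t > 0` the map `p + t (id - p)` carries the unit parallel body
bijectively onto the one of radius `t`, with Jacobian a positive polynomial in `t`.

The lower bound is Prékopa–Leindler for the indicator of `K` and a Gaussian, since `dist (a + b, K)
≤ |b|` for `a ∈ K`. -/

namespace Wills

/-! ### Layer-cake formula and Chebyshev's association inequality. -/

section LevelSets

lemma lintegral_Ici_exp_neg (c : ℝ) :
    ∫⁻ s in Ici c, ENNReal.ofReal (Real.exp (-s)) = ENNReal.ofReal (Real.exp (-c)) := by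
  rw [setLIntegral_congr Ioi_ae_eq_Ici.symm,
    ← ofReal_integral_eq_lintegral_ofReal (integrableOn_exp_neg_Ioi c)
      (ae_of_all _ fun s => (Real.exp_pos _).le), integral_exp_neg_Ioi]

lemma exp_neg_eq_lintegral {a : EReal} (ha : a ≠ ⊥) :
    EReal.exp (-a) = ∫⁻ s in {s : ℝ | a ≤ s}, ENNReal.ofReal (Real.exp (-s)) := by
  induction a with
  | bot => exact absurd rfl ha
  | top => simp
  | coe r =>
    have h : {s : ℝ | (r : EReal) ≤ s} = Ici r := by ext s; simp
    rw [h, lintegral_Ici_exp_neg, ← EReal.coe_neg, EReal.exp_coe]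

variable {X : Type*} [MeasurableSpace X]

/-- Layer-cake formula: `exp (-φ x)` is the tail integral of `exp (-s)` over `s ≥ φ x`, and Tonelli
exchanges the two integrations. -/
lemma lintegral_exp_neg {φ : X → EReal} (hφ : Measurable φ) (hb : ∀ x, φ x ≠ ⊥)
    (μ : Measure X) [SFinite μ] :
    ∫⁻ x, EReal.exp (-φ x) ∂μ =
      ∫⁻ s : ℝ, ENNReal.ofReal (Real.exp (-s)) * μ {x | φ x ≤ s} := by
  have hm : MeasurableSet {p : X × ℝ | φ p.1 ≤ (p.2 : EReal)} :=
    measurableSet_le (hφ.comp measurable_fst) (measurable_coe_real_ereal.comp measurable_snd)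
  have he : Measurable fun s : ℝ => ENNReal.ofReal (Real.exp (-s)) := by fun_prop
  calc ∫⁻ x, EReal.exp (-φ x) ∂μ
      = ∫⁻ x, ∫⁻ s : ℝ, {p : X × ℝ | φ p.1 ≤ (p.2 : EReal)}.indicator
          (fun p => ENNReal.ofReal (Real.exp (-p.2))) (x, s) ∂volume ∂μ := by
        refine lintegral_congr fun x => ?_
        rw [exp_neg_eq_lintegral (hb x), ← lintegral_indicator]
        · rfl
        · exact measurableSet_le measurable_const measurable_coe_real_ereal
    _ = ∫⁻ s : ℝ, ∫⁻ x, {p : X × ℝ | φ p.1 ≤ (p.2 : EReal)}.indicator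
          (fun p => ENNReal.ofReal (Real.exp (-p.2))) (x, s) ∂μ ∂volume := by
        apply lintegral_lintegral_swap
        exact ((he.comp measurable_snd).indicator hm).aemeasurable
    _ = _ := by
        refine lintegral_congr fun s => ?_
        rw [← lintegral_indicator_const]
        · rfl
        · exact measurableSet_le hφ measurable_const

lemma mul_add_mul_le_of_le {a b c d : ℝ≥0∞} (hab : a ≤ b) (hcd : c ≤ d) :
    a * d + b * c ≤ a * c + b * d := by
  obtain ⟨x, rfl⟩ := exists_add_of_le hab
  obtain ⟨y, rfl⟩ := exists_add_of_le hcd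
  calc a * (c + y) + (a + x) * c ≤ a * (c + y) + (a + x) * c + x * y := le_self_add
    _ = _ := by ring

/-- Chebyshev's association inequality for two increasing functions. -/
lemma lintegral_mul_lintegral_le_of_monotone (ν : Measure ℝ) [IsFiniteMeasure ν]
    {a b : ℝ → ℝ≥0∞} (ha : Monotone a) (hb : Monotone b) :
    (∫⁻ s, a s ∂ν) * ∫⁻ s, b s ∂ν ≤ ν univ * ∫⁻ s, a s * b s ∂ν := by
  -- This is `(a s - a t) * (b s - b t) ≥ 0` written without subtraction; it is integrated over `ν ×
  -- ν`.
  have key : ∀ s t, a s * b t + a t * b s ≤ a s * b s + a t * b t := by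
    intro s t
    rcases le_total s t with h | h
    · exact mul_add_mul_le_of_le (ha h) (hb h)
    · have := mul_add_mul_le_of_le (ha h) (hb h)
      rwa [add_comm, add_comm (a s * b s)]
  have hma := ha.measurable
  have hmab : Measurable fun s => a s * b s := ha.measurable.mul hb.measurable
  have hmb := hb.measurable
  have h2 : 2 * ((∫⁻ s, a s ∂ν) * ∫⁻ s, b s ∂ν) ≤ 2 * (ν univ * ∫⁻ s, a s * b s ∂ν) := by
    have h := lintegral_mono (μ := ν) fun s => lintegral_mono (μ := ν) fun t => key s t
    have e1 : ∫⁻ s, ∫⁻ t, a s * b t + a t * b s ∂ν ∂ν = 2 * ((∫⁻ s, a s ∂ν) * ∫⁻ s, b s ∂ν) := by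
      have : ∀ s, ∫⁻ t, a s * b t + a t * b s ∂ν =
          a s * (∫⁻ t, b t ∂ν) + (∫⁻ t, a t ∂ν) * b s := by
        intro s
        rw [lintegral_add_left (hmb.const_mul _), lintegral_const_mul _ hmb,
          lintegral_mul_const _ hma]
      simp_rw [this]
      rw [lintegral_add_left (hma.mul_const _), lintegral_const_mul _ hmb,
        lintegral_mul_const _ hma, two_mul]
    have e2 : ∫⁻ s, ∫⁻ t, a s * b s + a t * b t ∂ν ∂ν = 2 * (ν univ * ∫⁻ s, a s * b s ∂ν) := by
      have : ∀ s, ∫⁻ t, a s * b s + a t * b t ∂ν =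
          a s * b s * ν univ + ∫⁻ t, a t * b t ∂ν := by
        intro s
        rw [lintegral_add_left measurable_const, lintegral_const]
      simp_rw [this]
      rw [lintegral_add_left (hmab.mul_const _), lintegral_mul_const _ hmab,
        lintegral_const, two_mul, mul_comm]
    rwa [e1, e2] at h
  exact (ENNReal.mul_le_mul_iff_right (by norm_num) (by norm_num)).1 h2

/-- Chebyshev's inequality for the exponential distribution on `[c, ∞)`. -/
lemma lintegral_exp_neg_mul_lintegral_le {a b : ℝ → ℝ≥0∞} (ha : Monotone a) (hb : Monotone b)
    (c : ℝ) (ha0 : ∀ s < c, a s = 0) (hb0 : ∀ s < c, b s = 0) :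
    (∫⁻ s, ENNReal.ofReal (Real.exp (-s)) * a s) * (∫⁻ s, ENNReal.ofReal (Real.exp (-s)) * b s) ≤
      ENNReal.ofReal (Real.exp (-c)) *
        ∫⁻ s, ENNReal.ofReal (Real.exp (-s)) * (a s * b s) := by
  have he : Measurable fun s : ℝ => ENNReal.ofReal (Real.exp (-s)) := by fun_prop
  -- The total mass of `ν` is `exp (-c)`, the constant in the conclusion. As `a` and `b` vanish
  -- below `c`, restricting to `[c, ∞)` loses nothing.
  set ν : Measure ℝ := (volume.restrict (Ici c)).withDensity
    fun s => ENNReal.ofReal (Real.exp (-s)) with hν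
  have huniv : ν univ = ENNReal.ofReal (Real.exp (-c)) := by
    rw [hν, withDensity_apply _ MeasurableSet.univ, Measure.restrict_univ, lintegral_Ici_exp_neg]
  have : IsFiniteMeasure ν := ⟨by rw [huniv]; exact ENNReal.ofReal_lt_top⟩
  have hint : ∀ f : ℝ → ℝ≥0∞, Measurable f → (∀ s < c, f s = 0) →
      ∫⁻ s, f s ∂ν = ∫⁻ s, ENNReal.ofReal (Real.exp (-s)) * f s := by
    intro f hf h0
    rw [hν, lintegral_withDensity_eq_lintegral_mul _ he hf, ← lintegral_indicator measurableSet_Ici]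
    refine lintegral_congr fun s => ?_
    by_cases hs : c ≤ s
    · rw [indicator_of_mem (mem_Ici.2 hs)]; rfl
    · rw [indicator_of_notMem (by simpa using hs), h0 s (not_le.1 hs), mul_zero]
  have := lintegral_mul_lintegral_le_of_monotone ν ha hb
  rwa [huniv, hint a ha.measurable ha0, hint b hb.measurable hb0,
    hint (fun s => a s * b s) (ha.measurable.mul hb.measurable) fun s hs => by rw [ha0 s hs, zero_mul]] at this

end LevelSets

/-! ### The Rogers–Shephard inequality. -/

section RogersShephard

/-- The Beta integral: integration by parts lowers `b` by one and raises `a` by one. -/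
lemma integral_pow_mul_one_sub_pow (a b : ℕ) :
    ∫ v in (0 : ℝ)..1, v ^ a * (1 - v) ^ b =
      (a.factorial * b.factorial : ℝ) / ((a + b + 1).factorial : ℝ) := by
  induction b generalizing a with
  | zero =>
    simp only [pow_zero, mul_one, integral_pow, one_pow, Nat.factorial_zero, Nat.cast_one]
    rw [zero_pow (by omega), add_zero, Nat.factorial_succ, Nat.cast_mul]
    have := Nat.factorial_pos a
    field_simp
    push_cast
    ring
  | succ b ih =>
    have hd : ∀ v ∈ uIcc (0 : ℝ) 1, HasDerivAt (fun v : ℝ => v ^ (a + 1) * (1 - v) ^ (b + 1))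
        ((a + 1) * (v ^ a * (1 - v) ^ (b + 1)) - (b + 1) * (v ^ (a + 1) * (1 - v) ^ b)) v := by
      intro v _
      have h1 := hasDerivAt_pow (a + 1) v
      have h2 := ((hasDerivAt_id v).const_sub 1).pow (b + 1)
      refine (h1.mul h2).congr_deriv ?_
      simp only [Pi.pow_apply, id, Nat.add_sub_cancel]
      push_cast
      ring
    have hi := intervalIntegral.integral_eq_sub_of_hasDerivAt hd
      (Continuous.intervalIntegrable (by fun_prop) _ _)
    rw [intervalIntegral.integral_sub (Continuous.intervalIntegrable (by fun_prop) _ _)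
      (Continuous.intervalIntegrable (by fun_prop) _ _),
      intervalIntegral.integral_const_mul, intervalIntegral.integral_const_mul, ih] at hi
    simp only [one_pow, sub_self, ne_eq, Nat.succ_ne_zero, not_false_eq_true, zero_pow, mul_zero,
      zero_mul] at hi
    have ha : (0 : ℝ) < a + 1 := by positivity
    have h3 : a + (b + 1) + 1 = a + 1 + b + 1 := by ring
    rw [h3, ← mul_right_inj' ha.ne', sub_eq_zero.1 hi, Nat.factorial_succ a, Nat.factorial_succ b]
    push_cast
    ring

/-- The source of the binomial constant in the Rogers–Shephard inequality, in dimension `m + 1`. -/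
lemma lintegral_pow_mul_one_sub_pow (m : ℕ) :
    ∫⁻ v in Ioo (0 : ℝ) 1, ENNReal.ofReal ((m + 1 : ℕ) * v ^ m) *
        ENNReal.ofReal ((1 - v) ^ (m + 1)) =
      (((2 * (m + 1)).choose (m + 1) : ℕ) : ℝ≥0∞)⁻¹ := by
  have h1 : ∀ v ∈ Ioo (0 : ℝ) 1, ENNReal.ofReal ((m + 1 : ℕ) * v ^ m) *
      ENNReal.ofReal ((1 - v) ^ (m + 1)) =
        ENNReal.ofReal ((m + 1 : ℕ) * (v ^ m * (1 - v) ^ (m + 1))) := by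
    intro v hv
    have := hv.1
    rw [← ENNReal.ofReal_mul (by positivity), mul_assoc]
  have hc : Continuous fun v : ℝ => ((m + 1 : ℕ) : ℝ) * (v ^ m * (1 - v) ^ (m + 1)) := by fun_prop
  rw [setLIntegral_congr_fun measurableSet_Ioo h1, ← ofReal_integral_eq_lintegral_ofReal,
    ← integral_Ioc_eq_integral_Ioo, ← intervalIntegral.integral_of_le zero_le_one,
    intervalIntegral.integral_const_mul, integral_pow_mul_one_sub_pow,
    ← ENNReal.ofReal_natCast ((2 * (m + 1)).choose (m + 1)), ← ENNReal.ofReal_inv_of_pos]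
  · congr 1
    rw [two_mul, Nat.add_choose, Nat.cast_div (Nat.factorial_mul_factorial_dvd_factorial_add _ _)
      (by positivity), inv_div, show m + (m + 1) + 1 = m + 1 + (m + 1) by ring]
    push_cast [Nat.factorial_succ m]
    ring
  · exact_mod_cast Nat.choose_pos (by omega)
  · exact (hc.integrableOn_Icc (a := 0) (b := 1)).mono_set Ioo_subset_Icc_self
  · refine (ae_restrict_iff' measurableSet_Ioo).2 (ae_of_all _ fun v hv => ?_)
    have h2 := hv.1
    have h3 : 0 < 1 - v := sub_pos.2 hv.2
    simp only [Pi.zero_apply]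
    positivity

lemma mem_singleton_sub_iff {V : Type*} [AddCommGroup V] {p z : V} {K : Set V} : z ∈ {p} - K ↔ p - z ∈ K := by
  rw [singleton_sub]
  constructor
  · rintro ⟨k, hk, rfl⟩
    simpa using hk
  · intro h
    exact ⟨p - z, h, by simp⟩

lemma setLIntegral_singleton_sub {V : Type*} [AddCommGroup V] [MeasurableSpace V]
    [MeasurableSub₂ V] (μ : Measure V) {K : Set V} (hK : MeasurableSet K) (G : V → ℝ≥0∞) (p : V) :
    ∫⁻ z in {p} - K, G z ∂μ = ∫⁻ z, K.indicator 1 (p - z) * G z ∂μ := by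
  have hm : MeasurableSet ({p} - K) := by
    have : {p} - K = (fun z => p - z) ⁻¹' K := by
      ext z; exact mem_singleton_sub_iff
    rw [this]
    exact (measurable_const.sub measurable_id) hK
  rw [← lintegral_indicator hm]
  refine lintegral_congr fun z => ?_
  by_cases h : p - z ∈ K
  · rw [indicator_of_mem (mem_singleton_sub_iff.2 h), indicator_of_mem h]; simp
  · rw [indicator_of_notMem (mem_singleton_sub_iff.not.2 h), indicator_of_notMem h]; simp

variable {V : Type*} [NormedAddCommGroup V] [NormedSpace ℝ V] [FiniteDimensional ℝ V]
  [MeasurableSpace V] [BorelSpace V] (μ : Measure V) [μ.IsAddHaarMeasure]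

lemma measurable_uncurry_indicator_sub {K : Set V} (hK : MeasurableSet K) {G : V → ℝ≥0∞}
    (hG : Measurable G) :
    Measurable fun q : V × V => K.indicator (1 : V → ℝ≥0∞) (q.1 - q.2) * G q.2 :=
  ((measurable_one.indicator hK).comp (measurable_fst.sub measurable_snd)).mul
    (hG.comp measurable_snd)

lemma measurable_setLIntegral_singleton_sub {K : Set V} (hK : MeasurableSet K) {G : V → ℝ≥0∞}
    (hG : Measurable G) : Measurable fun p => ∫⁻ z in {p} - K, G z ∂μ := by
  simp_rw [setLIntegral_singleton_sub μ hK]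
  exact (measurable_uncurry_indicator_sub hK hG).lintegral_prod_right'

/-- The inner integral is the convolution of the indicator of `K` with `G`, so its total integral is
a product. -/
lemma lintegral_setLIntegral_singleton_sub {K : Set V} (hK : MeasurableSet K) {G : V → ℝ≥0∞}
    (hG : Measurable G) :
    ∫⁻ p, ∫⁻ z in {p} - K, G z ∂μ ∂μ = μ K * ∫⁻ z, G z ∂μ := by
  simp_rw [setLIntegral_singleton_sub μ hK]
  rw [lintegral_lintegral_swap (measurable_uncurry_indicator_sub hK hG).aemeasurable,
    ← lintegral_const_mul _ hG]
  refine lintegral_congr fun z => ?_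
  rw [lintegral_mul_const]
  · rw [lintegral_sub_right_eq_self (fun p => K.indicator (1 : V → ℝ≥0∞) p) z,
      lintegral_indicator_one hK]
  · exact (measurable_one.indicator hK).comp (measurable_id.sub_const z)

/-- The measure of `(p - K) ∩ L`, for `p` on the segment from `y` to `k + w`. -/
lemma measure_sub_inter_ge {K L : Set V} (hK : Convex ℝ K) (hL : Convex ℝ L) (y : V) {k w : V}
    (hk : k ∈ K) (hw : w ∈ L) {v : ℝ} (h0 : 0 < v) (h1 : v < 1) :
    ENNReal.ofReal (v ^ Module.finrank ℝ V) * μ (({y} - K) ∩ L) ≤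
      μ (({v • y + (1 - v) • (k + w)} - K) ∩ L) := by
  have h := Measure.addHaar_image_homothety μ ((1 - v) • w) 1 (({y} - K) ∩ L)
  -- The homothety with centre `w` and ratio `v` keeps `L` inside itself. It sends `y - K` into `p -
  -- K` because `p - (v z + (1 - v) w) = v (y - z) + (1 - v) k`.
  have hsub : (fun z => v • z + (1 - v) • w) '' (({y} - K) ∩ L) ⊆
      ({v • y + (1 - v) • (k + w)} - K) ∩ L := by
    rintro _ ⟨z, ⟨hz1, hz2⟩, rfl⟩
    refine ⟨mem_singleton_sub_iff.2 ?_, hL hz2 hw h0.le (sub_pos.2 h1).le (by ring)⟩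
    convert hK (mem_singleton_sub_iff.1 hz1) hk h0.le (sub_pos.2 h1).le (by ring) using 1
    module
  refine le_trans (le_of_eq ?_) (measure_mono hsub)
  have : (fun z => v • z + (1 - v) • w) '' (({y} - K) ∩ L) =
      (fun z => z + (1 - v) • w) '' (v • (({y} - K) ∩ L)) := by
    rw [← image_smul, image_image]
  rw [this, image_add_right, measure_preimage_add_right, Measure.addHaar_smul,
    abs_of_pos (pow_pos h0 _)]

/-- The Rogers–Shephard inequality for `K` and `L`: the sumset enters through a subset `D`. -/
lemma measure_mul_measure_sub_inter_le {K L D : Set V} (hK : Convex ℝ K) (hL : Convex ℝ L)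
    (hKm : MeasurableSet K) (hLm : MeasurableSet L) (hKf : μ K ≠ ∞) (hD : D ⊆ K + L) (y : V) :
    μ D * μ (({y} - K) ∩ L) ≤
      ((2 * Module.finrank ℝ V).choose (Module.finrank ℝ V) : ℕ) * (μ K * μ L) := by
  rcases Nat.eq_zero_or_pos (Module.finrank ℝ V) with hn | hn
  · have : Subsingleton V := Module.finrank_zero_iff.1 hn
    rw [hn, mul_zero, Nat.choose_self, Nat.cast_one, one_mul]
    refine mul_le_mul' (measure_mono fun x hx => ?_) (measure_mono inter_subset_right)
    obtain ⟨k, hk, -⟩ := hD hx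
    rwa [Subsingleton.elim x k]
  obtain ⟨m, hm⟩ : ∃ m, Module.finrank ℝ V = m + 1 := ⟨_, (Nat.succ_pred_eq_of_pos hn).symm⟩
  set V₀ := μ (({y} - K) ∩ L) with hV₀
  set H : V → ℝ≥0∞ := fun p => μ (({p} - K) ∩ L) with hH
  have hHint : ∀ p, H p = ∫⁻ z in {p} - K, L.indicator 1 z ∂μ := by
    intro p
    rw [lintegral_indicator_one hLm, Measure.restrict_apply hLm, inter_comm]
  have hHm : Measurable H := by
    simp_rw [funext hHint]
    exact measurable_setLIntegral_singleton_sub μ hKm (measurable_one.indicator hLm)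
  have hHf : ∀ p, H p ≠ ∞ := by
    intro p
    refine ne_top_of_le_ne_top hKf ((measure_mono inter_subset_left).trans (le_of_eq ?_))
    rw [sub_eq_add_neg, singleton_add, image_add_left, measure_preimage_add, Measure.measure_neg]
  have hHtot : ∫⁻ p, H p ∂μ = μ K * μ L := by
    simp_rw [hHint]
    rw [lintegral_setLIntegral_singleton_sub μ hKm (measurable_one.indicator hLm),
      lintegral_indicator_one hLm]
  rcases eq_or_ne V₀ 0 with h0 | h0
  · rw [h0, mul_zero]; exact zero_le
  have hV₀f : V₀ ≠ ∞ := hHf y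
  -- The weight `c` is the derivative of `v ^ (m + 1)`. The function `c v * V₀` is integrated over
  -- `T` in two orders: a slice at fixed `p` contributes at most `H p`, with integral `μ K * μ L`,
  -- while a slice at fixed `v` contains a translate of `(1 - v) • D`.
  set c : ℝ → ℝ≥0∞ := fun v => ENNReal.ofReal ((m + 1 : ℕ) * v ^ m) with hc
  have hcm : Measurable c := by fun_prop
  set T : Set (V × ℝ) := {q | ENNReal.ofReal (q.2 ^ (m + 1)) * V₀ ≤ H q.1} with hT
  have hTm : MeasurableSet T :=
    measurableSet_le (by fun_prop) (hHm.comp measurable_fst)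
  have hfm : Measurable fun q : V × ℝ => T.indicator (fun q => c q.2 * V₀) q :=
    ((hcm.comp measurable_snd).mul_const _).indicator hTm
  have hupper : ∀ p, ∫⁻ v in Ioo (0 : ℝ) 1, T.indicator (fun q => c q.2 * V₀) (p, v) ≤ H p := by
    intro p
    -- The largest `v` satisfying `v ^ (m + 1) * V₀ ≤ H p`.
    set r : ℝ := (H p / V₀).toReal ^ (1 / ((m + 1 : ℕ) : ℝ)) with hr
    have hr0 : 0 ≤ r := by positivity
    have hrp : ENNReal.ofReal (r ^ (m + 1)) = H p / V₀ := by
      rw [hr, one_div, Real.rpow_inv_natCast_pow ENNReal.toReal_nonneg (by omega),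
        ENNReal.ofReal_toReal (ENNReal.div_ne_top (hHf p) h0)]
    have hle : ∀ v ∈ Ioo (0 : ℝ) 1, T.indicator (fun q => c q.2 * V₀) (p, v) ≤
        (Ioc 0 r).indicator (fun v => c v * V₀) v := by
      intro v hv
      by_cases h : (p, v) ∈ T
      · have hvr : v ≤ r := by
          have h2 : ENNReal.ofReal (v ^ (m + 1)) ≤ ENNReal.ofReal (r ^ (m + 1)) := by
            rw [hrp, ENNReal.le_div_iff_mul_le (Or.inl h0) (Or.inl hV₀f)]
            exact h
          exact le_of_pow_le_pow_left₀ (by omega) hr0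
            ((ENNReal.ofReal_le_ofReal_iff (by positivity)).1 h2)
        rw [indicator_of_mem h, indicator_of_mem (show v ∈ Ioc 0 r from ⟨hv.1, hvr⟩)]
      · rw [indicator_of_notMem h]; exact zero_le
    calc _ ≤ ∫⁻ v in Ioo (0 : ℝ) 1, (Ioc 0 r).indicator (fun v => c v * V₀) v :=
          setLIntegral_mono' measurableSet_Ioo hle
      _ ≤ ∫⁻ v, (Ioc 0 r).indicator (fun v => c v * V₀) v := setLIntegral_le_lintegral _ _
      _ = (∫⁻ v in Ioc 0 r, c v) * V₀ := by
          rw [lintegral_indicator measurableSet_Ioc, lintegral_mul_const _ hcm]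
      _ = ENNReal.ofReal (r ^ (m + 1)) * V₀ := by
          congr 1
          rw [hc, ← ofReal_integral_eq_lintegral_ofReal, ← intervalIntegral.integral_of_le hr0,
            intervalIntegral.integral_const_mul, integral_pow]
          · congr 1
            push_cast
            field_simp
            simp
          · exact (Continuous.integrableOn_Icc (by fun_prop)).mono_set Ioc_subset_Icc_self
          · refine (ae_restrict_iff' measurableSet_Ioc).2 (ae_of_all _ fun v hv => ?_)
            have h2 := hv.1
            simp only [Pi.zero_apply]
            positivity
      _ = H p := by rw [hrp, ENNReal.div_mul_cancel h0 hV₀f]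
  have hlower : ∀ v ∈ Ioo (0 : ℝ) 1, c v * ENNReal.ofReal ((1 - v) ^ (m + 1)) * (μ D * V₀) ≤
      ∫⁻ p, T.indicator (fun q => c q.2 * V₀) (p, v) ∂μ := by
    intro v hv
    have hsub : (fun x => v • y + x) '' ((1 - v) • D) ⊆ {p | (p, v) ∈ T} := by
      rintro _ ⟨_, ⟨x, hx, rfl⟩, rfl⟩
      obtain ⟨k, hk, w, hw, rfl⟩ := hD hx
      have := measure_sub_inter_ge μ hK hL y hk hw hv.1 hv.2
      rw [hm] at this
      exact this
    calc c v * ENNReal.ofReal ((1 - v) ^ (m + 1)) * (μ D * V₀)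
        = c v * V₀ * (ENNReal.ofReal ((1 - v) ^ (m + 1)) * μ D) := by ring
      _ = c v * V₀ * μ ((fun x => v • y + x) '' ((1 - v) • D)) := by
          rw [image_add_left, measure_preimage_add, Measure.addHaar_smul, hm,
            abs_of_pos (pow_pos (sub_pos.2 hv.2) _)]
      _ ≤ c v * V₀ * μ {p | (p, v) ∈ T} := by gcongr
      _ = _ := by
          have hTv : MeasurableSet {p | (p, v) ∈ T} := measurable_prodMk_right hTm
          rw [← lintegral_indicator_const hTv]
          rfl
  have hmain : (((2 * (m + 1)).choose (m + 1) : ℕ) : ℝ≥0∞)⁻¹ * (μ D * V₀) ≤ μ K * μ L := by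
    calc _ = ∫⁻ v in Ioo (0 : ℝ) 1, c v * ENNReal.ofReal ((1 - v) ^ (m + 1)) * (μ D * V₀) := by
          rw [lintegral_mul_const _ (by fun_prop), lintegral_pow_mul_one_sub_pow]
      _ ≤ ∫⁻ v in Ioo (0 : ℝ) 1, ∫⁻ p, T.indicator (fun q => c q.2 * V₀) (p, v) ∂μ :=
          setLIntegral_mono' measurableSet_Ioo hlower
      _ = ∫⁻ p, ∫⁻ v in Ioo (0 : ℝ) 1, T.indicator (fun q => c q.2 * V₀) (p, v) ∂volume ∂μ :=
          (lintegral_lintegral_swap hfm.aemeasurable).symm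
      _ ≤ ∫⁻ p, H p ∂μ := lintegral_mono hupper
      _ = _ := hHtot
  rw [hm]
  have hC : (((2 * (m + 1)).choose (m + 1) : ℕ) : ℝ≥0∞) ≠ 0 := by
    exact_mod_cast (Nat.choose_pos (by omega)).ne'
  calc μ D * V₀ = (((2 * (m + 1)).choose (m + 1) : ℕ) : ℝ≥0∞) *
        ((((2 * (m + 1)).choose (m + 1) : ℕ) : ℝ≥0∞)⁻¹ * (μ D * V₀)) := by
        rw [← mul_assoc, ENNReal.mul_inv_cancel hC (ENNReal.natCast_ne_top _), one_mul]
    _ ≤ _ := by gcongr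

end RogersShephard

/-! ### Gauges, relative distance, and sublevel sets of convex profiles. -/

section Gauge

variable {n : ℕ} {K E : Set (EuclideanSpace ℝ (Fin n))}

local notation "𝔼" n => EuclideanSpace ℝ (Fin n)

/-- Monotonicity is known on `[0, ∞)` only; `t ↦ u (max t 0)` is monotone on the whole line, hence
measurable. -/
lemma measurable_comp_of_monotoneOn {X : Type*} [MeasurableSpace X] {u : ℝ → EReal}
    (hu : MonotoneOn u (Ici 0)) {f : X → ℝ} (hf : Measurable f) (h0 : ∀ x, 0 ≤ f x) :
    Measurable fun x => u (f x) := by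
  have hm : Monotone fun t : ℝ => u (max t 0) := fun s t hst =>
    hu (mem_Ici.2 (le_max_right _ _)) (mem_Ici.2 (le_max_right _ _)) (max_le_max_right _ hst)
  have h := hm.measurable.comp hf
  have he : (fun x => u (f x)) = (fun t : ℝ => u (max t 0)) ∘ f := by
    funext x
    simp [max_eq_left (h0 x)]
  rwa [he]

lemma absorbent_of_zero_mem_interior (hE0 : (0 : 𝔼 n) ∈ interior E) : Absorbent ℝ E :=
  absorbent_nhds_zero (mem_interior_iff_mem_nhds.1 hE0)

lemma gauge_convex_combo (hE : Convex ℝ E) (hE0 : (0 : 𝔼 n) ∈ interior E) {a b : ℝ}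
    (ha : 0 ≤ a) (hb : 0 ≤ b) (w z : 𝔼 n) :
    gauge E (a • w + b • z) ≤ a * gauge E w + b * gauge E z := by
  refine (gauge_add_le hE (absorbent_of_zero_mem_interior hE0) _ _).trans (le_of_eq ?_)
  rw [gauge_smul_of_nonneg ha, gauge_smul_of_nonneg hb, smul_eq_mul, smul_eq_mul]

lemma exists_relDist_eq (hE : Convex ℝ E) (hE0 : (0 : 𝔼 n) ∈ interior E) (hK : IsCompact K)
    (hKn : K.Nonempty) (x : 𝔼 n) : ∃ k ∈ K, relDist E x K = gauge E (x - k) := by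
  have hc : Continuous fun k => gauge E (x - k) :=
    (continuous_gauge hE (mem_interior_iff_mem_nhds.1 hE0)).comp (by fun_prop)
  obtain ⟨k, hk, h⟩ := hK.exists_sInf_image_eq hKn hc.continuousOn
  exact ⟨k, hk, h⟩

lemma relDist_nonneg (x : 𝔼 n) : 0 ≤ relDist E x K :=
  Real.sInf_nonneg (by rintro _ ⟨y, -, rfl⟩; exact gauge_nonneg _)

lemma relDist_le {k : 𝔼 n} (hk : k ∈ K) (x : 𝔼 n) : relDist E x K ≤ gauge E (x - k) :=
  csInf_le ⟨0, by rintro _ ⟨y, -, rfl⟩; exact gauge_nonneg _⟩ ⟨k, hk, rfl⟩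

lemma continuous_relDist (hE : Convex ℝ E) (hE0 : (0 : 𝔼 n) ∈ interior E) (hK : IsCompact K)
    (hKn : K.Nonempty) : Continuous fun x => relDist E x K := by
  obtain ⟨C, hC⟩ := hE.lipschitz_gauge (mem_interior_iff_mem_nhds.1 hE0)
  refine (LipschitzWith.of_le_add_mul C fun x y => ?_).continuous
  obtain ⟨k, hk, h⟩ := exists_relDist_eq hE hE0 hK hKn y
  have h1 := hC.le_add_mul (x - k) (y - k)
  rw [dist_sub_right] at h1
  rw [h]
  exact (relDist_le hk x).trans h1

lemma smul_eq_gauge_le (hE : Convex ℝ E) (hE0 : (0 : 𝔼 n) ∈ interior E) (hEc : IsCompact E)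
    {r : ℝ} (hr : 0 ≤ r) : r • E = {x | gauge E x ≤ r} := by
  ext x
  refine ⟨fun hx => gauge_le_of_mem hr hx, fun hx => ?_⟩
  have hn := mem_interior_iff_mem_nhds.1 hE0
  -- At radius `0` boundedness of `E` matters: it makes the gauge vanish at the origin only.
  rcases hr.eq_or_lt with rfl | hr
  · have h0 : gauge E x = 0 := le_antisymm hx (gauge_nonneg _)
    rw [gauge_eq_zero (absorbent_nhds_zero hn) (NormedSpace.isVonNBounded_of_isBounded _
      hEc.isBounded)] at h0
    exact ⟨0, interior_subset hE0, by simp [h0]⟩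
  · rw [mem_smul_set_iff_inv_smul_mem₀ hr.ne']
    rw [← hEc.isClosed.closure_eq, ← gauge_le_one_iff_mem_closure hE hn,
      gauge_smul_of_nonneg (inv_nonneg.2 hr.le), smul_eq_mul, inv_mul_le_iff₀ hr, mul_one]
    exact hx

lemma volume_sublevel_gauge {u : ℝ → EReal} (hu : MonotoneOn u (Ici 0)) (hE : Convex ℝ E)
    (hE0 : (0 : 𝔼 n) ∈ interior E) (hEc : IsCompact E) {s : ℝ} (hs : u 0 ≤ s)
    (hb : BddAbove {t : ℝ | 0 ≤ t ∧ u t ≤ s}) :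
    volume {x : 𝔼 n | u (gauge E x) ≤ s} = ENNReal.ofReal (inverse u s ^ n) * volume E := by
  have hvol : ∀ r : ℝ, 0 ≤ r → volume (r • E) = ENNReal.ofReal (r ^ n) * volume E := by
    intro r hr
    rw [Measure.addHaar_smul, finrank_euclideanSpace_fin, abs_of_nonneg (pow_nonneg hr _)]
  have hr0 : 0 ≤ inverse u s := Real.sSup_nonneg fun t ht => ht.1
  apply le_antisymm
  · rw [← hvol _ hr0, smul_eq_gauge_le hE hE0 hEc hr0]
    exact measure_mono fun x hx => le_csSup hb ⟨gauge_nonneg _, hx⟩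
  -- The supremum defining `inverse u s` need not be attained, as `u` may jump to `∞` there. The
  -- volume inequality holds for all smaller admissible radii and defines a closed condition, so it
  -- passes to the supremum.
  · have hcl : IsClosed {t : ℝ | ENNReal.ofReal (t ^ n) * volume E ≤
        volume {x : 𝔼 n | u (gauge E x) ≤ s}} := by
      refine isClosed_le ?_ continuous_const
      exact (ENNReal.continuous_mul_const hEc.measure_ne_top).comp
        (ENNReal.continuous_ofReal.comp (by fun_prop))
    refine hcl.closure_subset_iff.2 (fun t ht => ?_) (csSup_mem_closure ⟨0, le_rfl, hs⟩ hb)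
    rw [mem_ofPred_eq, ← hvol t ht.1]
    exact measure_mono fun x hx =>
      (hu (gauge_nonneg _) ht.1 (gauge_le_of_mem ht.1 hx)).trans ht.2

lemma lintegral_exp_neg_gauge {u : ℝ → EReal} (hu : MonotoneOn u (Ici 0))
    (hbot : ∀ t, 0 ≤ t → u t ≠ ⊥) (hb : ∀ s : ℝ, BddAbove {t : ℝ | 0 ≤ t ∧ u t ≤ s})
    (hE : Convex ℝ E) (hE0 : (0 : 𝔼 n) ∈ interior E) (hEc : IsCompact E) :
    ∫⁻ x, EReal.exp (-u (gauge E x)) = moment u n * volume E := by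
  have hg : Measurable (gauge E) :=
    (continuous_gauge hE (mem_interior_iff_mem_nhds.1 hE0)).measurable
  have hS : MeasurableSet {s : ℝ | u 0 ≤ (s : EReal)} :=
    measurableSet_le measurable_const measurable_coe_real_ereal
  rw [lintegral_exp_neg (measurable_comp_of_monotoneOn hu hg fun x => gauge_nonneg _)
    fun x => hbot _ (gauge_nonneg _), moment, ← lintegral_mul_const' _ _ hEc.measure_ne_top,
    ← lintegral_indicator hS]
  refine lintegral_congr fun s => ?_
  by_cases hs : u 0 ≤ s
  · have hr0 : 0 ≤ inverse u s := Real.sSup_nonneg fun t ht => ht.1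
    rw [indicator_of_mem (by exact hs), volume_sublevel_gauge hu hE hE0 hEc hs (hb s),
      ENNReal.ofReal_mul (pow_nonneg hr0 _)]
    ring
  · rw [indicator_of_notMem (by exact hs)]
    have : {x : 𝔼 n | u (gauge E x) ≤ s} = ∅ := by
      refine eq_empty_of_forall_notMem fun x hx => hs ?_
      exact (hu self_mem_Ici (gauge_nonneg _) (gauge_nonneg _)).trans hx
    rw [this, measure_empty, mul_zero]

lemma IsConvexIncreasing.convex_sublevel {u : ℝ → EReal} (hu : IsConvexIncreasing u)
    (hE : Convex ℝ E) (hE0 : (0 : 𝔼 n) ∈ interior E) (s : ℝ) :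
    Convex ℝ {x : 𝔼 n | u (gauge E x) ≤ s} := by
  intro w hw z hz a b ha hb hab
  have h0 : 0 ≤ a * gauge E w + b * gauge E z :=
    add_nonneg (mul_nonneg ha (gauge_nonneg _)) (mul_nonneg hb (gauge_nonneg _))
  calc u (gauge E (a • w + b • z)) ≤ u (a * gauge E w + b * gauge E z) :=
        hu.monotoneOn (gauge_nonneg _) h0 (gauge_convex_combo hE hE0 ha hb w z)
    _ ≤ (a : EReal) * u (gauge E w) + (b : EReal) * u (gauge E z) :=
        hu.convex _ _ a b (gauge_nonneg _) (gauge_nonneg _) ha hb hab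
    _ ≤ (a : EReal) * s + (b : EReal) * s := by
        gcongr
        · exact hw
        · exact hz
    _ = s := by
        rw [← EReal.coe_mul, ← EReal.coe_mul, ← EReal.coe_add, ← add_mul, hab, one_mul]

lemma IsConvexIncreasing.exists_coe {u : ℝ → EReal} (hu : IsConvexIncreasing u) {t : ℝ}
    (ht : 0 ≤ t) (htop : u t ≠ ⊤) : ∃ r : ℝ, u t = r :=
  ⟨(u t).toReal, (EReal.coe_toReal htop (hu.ne_bot t ht)).symm⟩

/-- Beyond `t₁` a convex `u` lies above the line through `(0, u 0)` and `(t₁, u t₁)`, which has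
positive slope; the bound is where that line reaches height `s`. Without boundedness, `sSup` in
`inverse` would take its default value. -/
lemma IsConvexIncreasing.bddAbove_sublevel {u : ℝ → EReal} (hu : IsConvexIncreasing u)
    (hs : IsStrictlyIncreasing u) (s : ℝ) : BddAbove {t : ℝ | 0 ≤ t ∧ u t ≤ s} := by
  obtain ⟨t₁, ht₁, htop⟩ := hs.exists_pos
  have h0top : u 0 ≠ ⊤ := ne_top_of_le_ne_top htop
    (hu.monotoneOn self_mem_Ici ht₁.le ht₁.le)
  have hlt := hs.strictMonoOn ⟨le_rfl, h0top⟩ ⟨ht₁.le, htop⟩ ht₁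
  obtain ⟨a, ha⟩ := hu.exists_coe le_rfl h0top
  obtain ⟨b, hb⟩ := hu.exists_coe ht₁.le htop
  rw [ha, hb, EReal.coe_lt_coe_iff] at hlt
  refine ⟨max t₁ (t₁ * (s - a) / (b - a)), fun t ht => ?_⟩
  rcases le_or_gt t t₁ with h | h
  · exact h.trans (le_max_left _ _)
  refine le_trans ?_ (le_max_right _ _)
  have ht0 : 0 < t := ht₁.trans h
  obtain ⟨c, hc⟩ := hu.exists_coe ht0.le (ne_top_of_le_ne_top (EReal.coe_ne_top s) ht.2)
  have hcs : c ≤ s := by have := ht.2; rw [hc] at this; exact_mod_cast this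
  have hconv := hu.convex 0 t (1 - t₁ / t) (t₁ / t) le_rfl ht0.le
    (sub_nonneg.2 ((div_le_one ht0).2 h.le)) (by positivity) (by ring)
  rw [mul_zero, zero_add, div_mul_cancel₀ _ ht0.ne', hb, ha, hc, ← EReal.coe_mul,
    ← EReal.coe_mul, ← EReal.coe_add, EReal.coe_le_coe_iff] at hconv
  rw [le_div_iff₀ (sub_pos.2 hlt)]
  have h1 : t₁ / t * (c - a) ≤ t₁ / t * (s - a) := by gcongr
  have h2 : b - a ≤ t₁ / t * (s - a) := by linarith
  calc t * (b - a) ≤ t * (t₁ / t * (s - a)) := by gcongr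
    _ = t₁ * (s - a) := by field_simp

lemma le_half_of_two_mul_le {x : EReal} {s : ℝ} (h : 2 * x ≤ s) : x ≤ (s / 2 : ℝ) := by
  induction x with
  | bot => exact bot_le
  | top =>
    rw [EReal.mul_top_of_pos (by norm_num)] at h
    exact absurd (top_le_iff.1 h) (EReal.coe_ne_top s)
  | coe r =>
    have h2 : ((2 * r : ℝ) : EReal) ≤ s := by
      rw [EReal.coe_mul]; exact h
    have := EReal.coe_le_coe_iff.1 h2
    exact EReal.coe_le_coe_iff.2 (by linarith)

lemma two_mul_ereal_ne_bot {x : EReal} (h : x ≠ ⊥) : 2 * x ≠ ⊥ := by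
  induction x with
  | bot => exact absurd rfl h
  | top => rw [EReal.mul_top_of_pos (by norm_num)]; exact top_ne_bot
  | coe r =>
    have : (2 : EReal) * r = ((2 * r : ℝ) : EReal) := by rw [EReal.coe_mul]; rfl
    rw [this]; exact EReal.coe_ne_bot _

lemma exp_neg_mul_exp_neg_le {x a b : EReal} (ha : a ≠ ⊥) (hb : b ≠ ⊥)
    (h : x ≤ ((1 / 2 : ℝ) : EReal) * a + ((1 / 2 : ℝ) : EReal) * b) :
    EReal.exp (-a) * EReal.exp (-b) ≤ EReal.exp (-(2 * x)) := by
  induction a with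
  | bot => exact absurd rfl ha
  | top => simp
  | coe a =>
    induction b with
    | bot => exact absurd rfl hb
    | top => simp
    | coe b =>
      rw [← EReal.exp_add, EReal.exp_le_exp_iff]
      have h2 : (2 : EReal) * x ≤ ((a + b : ℝ) : EReal) := by
        calc (2 : EReal) * x ≤ 2 * (((1 / 2 : ℝ) : EReal) * a + ((1 / 2 : ℝ) : EReal) * b) := by
              gcongr
          _ = ((2 * (1 / 2 * a + 1 / 2 * b) : ℝ) : EReal) := by
              rw [EReal.coe_mul, EReal.coe_add, EReal.coe_mul, EReal.coe_mul]; rfl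
          _ = _ := by congr 1; ring
      calc -(a : EReal) + -(b : EReal) = -((a + b : ℝ) : EReal) := by
            rw [← EReal.coe_neg, ← EReal.coe_neg, ← EReal.coe_add, ← EReal.coe_neg]
            congr 1; ring
        _ ≤ _ := EReal.neg_le_neg_iff.2 h2

end Gauge

/-! ### The two upper bounds for the generalized Wills functional. -/

section GeneralBound

variable {n : ℕ} {K E : Set (EuclideanSpace ℝ (Fin n))}

local notation "𝔼" n => EuclideanSpace ℝ (Fin n)

lemma lintegral_comp_smul (F : (𝔼 n) → ℝ≥0∞) {r : ℝ} (hr : 0 < r) :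
    ∫⁻ z, F (r • z) = ENNReal.ofReal ((r ^ n)⁻¹) * ∫⁻ z, F z := by
  have h := (Homeomorph.smulOfNeZero r hr.ne' (α := 𝔼 n)).measurableEmbedding.lintegral_map
    (μ := volume) F
  have hm : Measure.map (Homeomorph.smulOfNeZero r hr.ne' (α := 𝔼 n)) volume =
      ENNReal.ofReal |(r ^ Module.finrank ℝ (𝔼 n))⁻¹| • volume :=
    Measure.map_addHaar_smul volume hr.ne'
  rw [hm, lintegral_smul_measure, finrank_euclideanSpace_fin,
    abs_of_pos (inv_pos.2 (pow_pos hr _)), smul_eq_mul] at h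
  exact h.symm

lemma lintegral_comp_midpoint (F : (𝔼 n) → ℝ≥0∞) (w : 𝔼 n) :
    ∫⁻ z, F ((1 / 2 : ℝ) • w + (1 / 2 : ℝ) • z) = 2 ^ n * ∫⁻ z, F z := by
  rw [lintegral_comp_smul (fun z => F ((1 / 2 : ℝ) • w + z)) (by norm_num),
    lintegral_add_left_eq_self F]
  congr 1
  rw [one_div, inv_pow, inv_inv, ENNReal.ofReal_pow (by norm_num)]
  norm_num

variable {u : ℝ → EReal}

lemma measurableSet_sub (hK : IsCompact K) (y : 𝔼 n) : MeasurableSet ({y} - K) :=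
  sub_eq_add_neg {y} K ▸ (isCompact_singleton.add hK.neg).measurableSet

lemma gaugeMeasure_sub (hK : IsCompact K) (y : 𝔼 n) :
    gaugeMeasure u E ({y} - K) = ∫⁻ z in {y} - K, EReal.exp (-u (gauge E z)) :=
  withDensity_apply _ (measurableSet_sub hK y)

lemma volume_singleton_sub (y : 𝔼 n) : volume ({y} - K) = volume K := by
  rw [sub_eq_add_neg, singleton_add, image_add_left, measure_preimage_add, Measure.measure_neg]

lemma genWills_mul_gaugeMeasure_le_choose (hu : IsConvexIncreasing u)
    (hb : ∀ s : ℝ, BddAbove {t : ℝ | 0 ≤ t ∧ u t ≤ s})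
    (hK : Convex ℝ K) (hKc : IsCompact K) (hKn : K.Nonempty)
    (hE : Convex ℝ E) (hE0 : (0 : 𝔼 n) ∈ interior E) (hEc : IsCompact E)
    {c : ℝ} (hc : u 0 = c) (y : 𝔼 n) :
    genWills u K E * gaugeMeasure u E ({y} - K) ≤
      ((2 * n).choose n : ℝ≥0∞) * EReal.exp (-u 0) * moment u n * (volume K * volume E) := by
  have hg : Measurable (gauge E) :=
    (continuous_gauge hE (mem_interior_iff_mem_nhds.1 hE0)).measurable
  have hug : Measurable fun x => u (gauge E x) :=
    measurable_comp_of_monotoneOn hu.monotoneOn hg fun x => gauge_nonneg _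
  have hud : Measurable fun x => u (relDist E x K) :=
    measurable_comp_of_monotoneOn hu.monotoneOn (continuous_relDist hE hE0 hKc hKn).measurable
      fun x => relDist_nonneg _
  have hLm : ∀ s : ℝ, MeasurableSet {z | u (gauge E z) ≤ s} := fun s =>
    measurableSet_le hug measurable_const
  set a : ℝ → ℝ≥0∞ := fun s => volume {x | u (relDist E x K) ≤ s} with ha
  set b : ℝ → ℝ≥0∞ := fun s => volume (({y} - K) ∩ {z | u (gauge E z) ≤ s}) with hbd
  have hW : genWills u K E = ∫⁻ s, ENNReal.ofReal (Real.exp (-s)) * a s :=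
    lintegral_exp_neg hud (fun x => hu.ne_bot _ (relDist_nonneg _)) volume
  have hM : gaugeMeasure u E ({y} - K) = ∫⁻ s, ENNReal.ofReal (Real.exp (-s)) * b s := by
    rw [gaugeMeasure_sub hKc, lintegral_exp_neg hug fun x => hu.ne_bot _ (gauge_nonneg _)]
    refine lintegral_congr fun s => ?_
    rw [Measure.restrict_apply (hLm s), inter_comm]
  have hmono : ∀ {s t : ℝ}, s ≤ t → ((s : ℝ) : EReal) ≤ (t : ℝ) := fun h =>
    EReal.coe_le_coe_iff.2 h
  have hempty : ∀ s < c, ∀ t, 0 ≤ t → ¬ u t ≤ s := by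
    intro s hs t ht h
    have h1 := (hu.monotoneOn self_mem_Ici ht ht).trans h
    rw [hc, EReal.coe_le_coe_iff] at h1
    exact absurd hs (not_lt.2 h1)
  rw [hW, hM]
  calc _ ≤ ENNReal.ofReal (Real.exp (-c)) *
        ∫⁻ s, ENNReal.ofReal (Real.exp (-s)) * (a s * b s) := by
        refine lintegral_exp_neg_mul_lintegral_le ?_ ?_ c ?_ ?_
        · exact fun s t hst => measure_mono fun x hx => le_trans hx (hmono hst)
        · exact fun s t hst => measure_mono (inter_subset_inter_right _ fun x hx =>
            le_trans hx (hmono hst))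
        · intro s hs
          have : {x | u (relDist E x K) ≤ s} = ∅ :=
            eq_empty_of_forall_notMem fun x hx => hempty s hs _ (relDist_nonneg _) hx
          rw [ha]; simp only [this, measure_empty]
        · intro s hs
          have : {x | u (gauge E x) ≤ s} = ∅ :=
            eq_empty_of_forall_notMem fun x hx => hempty s hs _ (gauge_nonneg _) hx
          rw [hbd]; simp only [this, inter_empty, measure_empty]
    _ ≤ ENNReal.ofReal (Real.exp (-c)) * ∫⁻ s, ENNReal.ofReal (Real.exp (-s)) *
        (((2 * n).choose n : ℕ) * (volume K * volume {z | u (gauge E z) ≤ s})) := by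
        refine mul_le_mul' le_rfl (lintegral_mono fun s => mul_le_mul' le_rfl ?_)
        have h := measure_mul_measure_sub_inter_le volume hK (hu.convex_sublevel hE hE0 s)
          hKc.measurableSet (hLm s) hKc.measure_ne_top
          (D := {x | u (relDist E x K) ≤ s}) ?_ y
        · rwa [finrank_euclideanSpace_fin] at h
        -- With `k` a nearest point of `K`, the decomposition `x = k + (x - k)` places the sublevel
        -- set inside the sumset.
        · intro x hx
          obtain ⟨k, hk, h⟩ := exists_relDist_eq hE hE0 hKc hKn x
          refine ⟨k, hk, x - k, ?_, by simp⟩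
          rw [mem_ofPred_eq, ← h]
          exact hx
    _ = ENNReal.ofReal (Real.exp (-c)) * (((2 * n).choose n : ℕ) * volume K *
          ∫⁻ s : ℝ, ENNReal.ofReal (Real.exp (-s)) * volume {z | u (gauge E z) ≤ s}) := by
        congr 1
        rw [← lintegral_const_mul' _ _
          (ENNReal.mul_ne_top (ENNReal.natCast_ne_top _) hKc.measure_ne_top)]
        refine lintegral_congr fun s => ?_
        ring
    _ = _ := by
        rw [← lintegral_exp_neg hug fun x => hu.ne_bot _ (gauge_nonneg _),
          lintegral_exp_neg_gauge hu.monotoneOn hu.ne_bot hb hE hE0 hEc, hc, ← EReal.coe_neg,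
          EReal.exp_coe]
        ring

/-- Let `k` be nearest to `x` and `w = x - k`. For `z ∈ y - K` the midpoint of `w` and `z` lies in
`(x + y) / 2 - K`, and convexity bounds the product of densities by the density of `2 u` there. The
factor `2 ^ n` is the Jacobian of the midpoint substitution. -/
lemma exp_neg_mul_gaugeMeasure_le (hu : IsConvexIncreasing u)
    (hK : Convex ℝ K) (hKc : IsCompact K) (hKn : K.Nonempty)
    (hE : Convex ℝ E) (hE0 : (0 : 𝔼 n) ∈ interior E) (x y : 𝔼 n) :
    EReal.exp (-u (relDist E x K)) * gaugeMeasure u E ({y} - K) ≤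
      2 ^ n * ∫⁻ z in {(1 / 2 : ℝ) • y + (1 / 2 : ℝ) • x} - K,
        EReal.exp (-(2 * u (gauge E z))) := by
  obtain ⟨k, hk, h⟩ := exists_relDist_eq hE hE0 hKc hKn x
  set w := x - k with hw
  set p := (1 / 2 : ℝ) • y + (1 / 2 : ℝ) • x with hp
  rw [gaugeMeasure_sub hKc, ← lintegral_indicator (measurableSet_sub hKc y),
    ← lintegral_indicator (measurableSet_sub hKc p), ← lintegral_comp_midpoint _ w,
    ← lintegral_const_mul']
  · refine lintegral_mono fun z => ?_
    by_cases hz : z ∈ {y} - K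
    · have hz' : (1 / 2 : ℝ) • w + (1 / 2 : ℝ) • z ∈ {p} - K := by
        rw [mem_singleton_sub_iff] at hz ⊢
        convert hK hk hz (by norm_num : (0 : ℝ) ≤ 1 / 2) (by norm_num : (0 : ℝ) ≤ 1 / 2)
          (by norm_num) using 1
        rw [hp, hw]
        module
      rw [indicator_of_mem hz, indicator_of_mem hz', h]
      refine exp_neg_mul_exp_neg_le (hu.ne_bot _ (gauge_nonneg _)) (hu.ne_bot _ (gauge_nonneg _)) ?_
      refine le_trans (hu.monotoneOn (gauge_nonneg _) ?_
        (gauge_convex_combo hE hE0 (by norm_num) (by norm_num) w z)) ?_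
      · exact add_nonneg (mul_nonneg (by norm_num) (gauge_nonneg _))
          (mul_nonneg (by norm_num) (gauge_nonneg _))
      · exact hu.convex _ _ _ _ (gauge_nonneg _) (gauge_nonneg _) (by norm_num) (by norm_num)
          (by norm_num)
    · rw [indicator_of_notMem hz, mul_zero]; exact zero_le
  · rw [Ne, EReal.exp_eq_top_iff, EReal.neg_eq_top_iff]
    exact hu.ne_bot _ (relDist_nonneg _)

lemma genWills_mul_gaugeMeasure_le_pow (hu : IsConvexIncreasing u)
    (hb : ∀ s : ℝ, BddAbove {t : ℝ | 0 ≤ t ∧ u t ≤ s})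
    (hK : Convex ℝ K) (hKc : IsCompact K) (hKn : K.Nonempty)
    (hE : Convex ℝ E) (hE0 : (0 : 𝔼 n) ∈ interior E) (hEc : IsCompact E) (y : 𝔼 n) :
    genWills u K E * gaugeMeasure u E ({y} - K) ≤
      4 ^ n * moment (fun t => 2 * u t) n * (volume K * volume E) := by
  have hg : Measurable (gauge E) :=
    (continuous_gauge hE (mem_interior_iff_mem_nhds.1 hE0)).measurable
  have hu2 : MonotoneOn (fun t => 2 * u t) (Ici 0) := by
    intro s hs t ht hst
    have := hu.monotoneOn hs ht hst
    dsimp only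
    gcongr
  have hG : Measurable fun z => EReal.exp (-(2 * u (gauge E z))) := by
    have h := measurable_comp_of_monotoneOn hu2 hg fun x => gauge_nonneg _
    exact EReal.measurable_exp.comp h.neg
  have hd : Measurable fun x => EReal.exp (-u (relDist E x K)) := by
    have h := measurable_comp_of_monotoneOn hu.monotoneOn
      (continuous_relDist hE hE0 hKc hKn).measurable fun x => relDist_nonneg _
    exact EReal.measurable_exp.comp h.neg
  calc genWills u K E * gaugeMeasure u E ({y} - K)
      = ∫⁻ x, EReal.exp (-u (relDist E x K)) * gaugeMeasure u E ({y} - K) := by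
        rw [lintegral_mul_const _ hd]; rfl
    _ ≤ ∫⁻ x, 2 ^ n * ∫⁻ z in {(1 / 2 : ℝ) • y + (1 / 2 : ℝ) • x} - K,
        EReal.exp (-(2 * u (gauge E z))) :=
        lintegral_mono fun x => exp_neg_mul_gaugeMeasure_le hu hK hKc hKn hE hE0 x y
    _ = 2 ^ n * (2 ^ n * ∫⁻ p, ∫⁻ z in {p} - K, EReal.exp (-(2 * u (gauge E z)))) := by
        rw [lintegral_const_mul' _ _ (by finiteness)]
        -- The substitution `p = (y + x) / 2` yields the second factor `2 ^ n`.
        exact congrArg _ <| lintegral_comp_midpoint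
          (fun p => ∫⁻ z in {p} - K, EReal.exp (-(2 * u (gauge E z)))) y
    _ = 2 ^ n * (2 ^ n * (volume K * (moment (fun t => 2 * u t) n * volume E))) := by
        rw [lintegral_setLIntegral_singleton_sub _ hKc.measurableSet hG,
          lintegral_exp_neg_gauge hu2 (fun t ht => two_mul_ereal_ne_bot (hu.ne_bot t ht)) ?_
            hE hE0 hEc]
        intro s
        refine (hb (s / 2)).mono fun t ht => ?_
        exact ⟨ht.1, le_half_of_two_mul_le ht.2⟩
    _ = _ := by
        have : (4 : ℝ≥0∞) ^ n = 2 ^ n * 2 ^ n := by rw [← mul_pow]; norm_num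
        rw [this]; ring

lemma gaugeMeasure_sub_le (hu : IsConvexIncreasing u) (hKc : IsCompact K) (y : 𝔼 n) :
    gaugeMeasure u E ({y} - K) ≤ EReal.exp (-u 0) * volume K := by
  rw [gaugeMeasure_sub hKc, ← volume_singleton_sub y (K := K), ← setLIntegral_const]
  exact lintegral_mono fun z => EReal.exp_monotone (EReal.neg_le_neg_iff.2
    (hu.monotoneOn self_mem_Ici (gauge_nonneg _) (gauge_nonneg _)))

/-- Near the origin, which is interior to `y - K`, the density is at least `exp (-u t) > 0`. -/
lemma gaugeMeasure_sub_pos (hu : IsConvexIncreasing u) (hs : IsStrictlyIncreasing u)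
    (hKc : IsCompact K) (hE : Convex ℝ E) (hE0 : (0 : 𝔼 n) ∈ interior E)
    {y : 𝔼 n} (hy : y ∈ interior K) : 0 < gaugeMeasure u E ({y} - K) := by
  obtain ⟨t, ht, htop⟩ := hs.exists_pos
  have hg := continuous_gauge hE (mem_interior_iff_mem_nhds.1 hE0)
  set U : Set (𝔼 n) := (fun z => y - z) ⁻¹' interior K ∩ {z | gauge E z < t} with hU
  have hUo : IsOpen U :=
    (isOpen_interior.preimage (by fun_prop)).inter (isOpen_lt hg continuous_const)
  have hU0 : (0 : 𝔼 n) ∈ U := ⟨by simpa using hy, by simpa using ht⟩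
  have hUK : U ⊆ {y} - K := fun z hz => mem_singleton_sub_iff.2 (interior_subset hz.1)
  have hpos : 0 < EReal.exp (-u t) := by
    rw [EReal.zero_lt_exp_iff, bot_lt_iff_ne_bot, Ne, EReal.neg_eq_bot_iff]
    exact htop
  calc 0 < EReal.exp (-u t) * volume U :=
        ENNReal.mul_pos hpos.ne' (hUo.measure_pos _ ⟨0, hU0⟩).ne'
    _ = ∫⁻ z in U, EReal.exp (-u t) := (setLIntegral_const _ _).symm
    _ ≤ ∫⁻ z in U, EReal.exp (-u (gauge E z)) :=
        setLIntegral_mono' hUo.measurableSet fun z hz => EReal.exp_monotone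
          (EReal.neg_le_neg_iff.2 (hu.monotoneOn (gauge_nonneg _) ht.le hz.2.le))
    _ ≤ ∫⁻ z in {y} - K, EReal.exp (-u (gauge E z)) := lintegral_mono_set hUK
    _ = _ := (gaugeMeasure_sub hKc y).symm

lemma le_min_mul {a b c x : ℝ≥0∞} (ha : x ≤ a * c) (hb : x ≤ b * c) : x ≤ min a b * c := by
  rcases le_total a b with h | h
  · rwa [min_eq_left h]
  · rwa [min_eq_right h]

theorem genWills_le (hu : IsConvexIncreasing u) (hs : IsStrictlyIncreasing u)
    (hK : Convex ℝ K) (hKc : IsCompact K) (hKi : (interior K).Nonempty)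
    (hE : Convex ℝ E) (hE0 : (0 : 𝔼 n) ∈ interior E) (hEc : IsCompact E) :
    genWills u K E ≤ min (((2 * n).choose n : ℝ≥0∞) * EReal.exp (-u 0) * moment u n)
        ((4 : ℝ≥0∞) ^ n * moment (fun t => 2 * u t) n) * (volume K * volume E) /
      ⨆ y : 𝔼 n, gaugeMeasure u E ({y} - K) := by
  have hb := hu.bddAbove_sublevel hs
  have hKn : K.Nonempty := hKi.mono interior_subset
  obtain ⟨t, ht, htop⟩ := hs.exists_pos
  have h0top : u 0 ≠ ⊤ := ne_top_of_le_ne_top htop (hu.monotoneOn self_mem_Ici ht.le ht.le)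
  obtain ⟨c, hc⟩ := hu.exists_coe le_rfl h0top
  obtain ⟨y₀, hy₀⟩ := hKi
  -- Turning the product bound into a quotient requires the supremum to be neither `0` nor `∞`.
  rw [ENNReal.le_div_iff_mul_le]
  · rw [ENNReal.mul_iSup]
    refine iSup_le fun y => ?_
    have h1 := genWills_mul_gaugeMeasure_le_choose hu hb hK hKc hKn hE hE0 hEc hc y
    have h2 := genWills_mul_gaugeMeasure_le_pow hu hb hK hKc hKn hE hE0 hEc y
    exact le_min_mul h1 h2
  · left
    have h1 := gaugeMeasure_sub_pos hu hs hKc hE hE0 hy₀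
    have h2 := le_iSup (fun y : 𝔼 n => gaugeMeasure u E ({y} - K)) y₀
    have h4 : 0 < ⨆ y : 𝔼 n, gaugeMeasure u E ({y} - K) := lt_of_lt_of_le h1 h2
    exact h4.ne'
  · left
    refine ne_top_of_le_ne_top ?_ (iSup_le fun y => gaugeMeasure_sub_le hu hKc y)
    rw [hc, ← EReal.coe_neg, EReal.exp_coe]
    exact ENNReal.mul_ne_top ENNReal.ofReal_ne_top hKc.measure_ne_top

end GeneralBound

/-! ### The Steiner formula through the nearest-point map. -/

section Steiner

variable {V : Type*} [NormedAddCommGroup V] [InnerProductSpace ℝ V]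

/-- `p` maps every point to the nearest point of the convex set `K`. -/
def IsNearestPointMap (K : Set V) (p : V → V) : Prop :=
  ∀ x, p x ∈ K ∧ ∀ w ∈ K, inner ℝ (x - p x) (w - p x) ≤ 0

lemma exists_isNearestPointMap {K : Set V} (hK : Convex ℝ K) (hc : IsComplete K)
    (hn : K.Nonempty) : ∃ p, IsNearestPointMap K p := by
  have : ∀ x, ∃ q ∈ K, ∀ w ∈ K, inner ℝ (x - q) (w - q) ≤ 0 := fun x => by
    obtain ⟨q, hq, h⟩ := exists_norm_eq_iInf_of_complete_convex hn hc hK x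
    exact ⟨q, hq, (norm_eq_iInf_iff_real_inner_le_zero hK hq).1 h⟩
  choose p hp h using this
  exact ⟨p, fun x => ⟨hp x, h x⟩⟩

namespace IsNearestPointMap

variable {K : Set V} {p : V → V}

/-- Firm nonexpansiveness: add the variational inequality at `x` tested with `p y` and the one at
`y` tested with `p x`. It gives the Lipschitz bound and, differentiated, positivity of the Jacobian.
-/
lemma norm_sub_sq_le_inner (h : IsNearestPointMap K p) (x y : V) :
    ‖p x - p y‖ ^ 2 ≤ inner ℝ (x - y) (p x - p y) := by
  have h1 := (h x).2 (p y) (h y).1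
  have h2 := (h y).2 (p x) (h x).1
  rw [← real_inner_self_eq_norm_sq]
  have : inner ℝ (x - y) (p x - p y) = inner ℝ (p x - p y) (p x - p y) -
      inner ℝ (x - p x) (p y - p x) - inner ℝ (y - p y) (p x - p y) := by
    rw [← neg_sub (p x) (p y), inner_neg_right, sub_neg_eq_add, ← inner_add_left, ← inner_sub_left]
    congr 1
    abel
  linarith

lemma norm_sub_le (h : IsNearestPointMap K p) (x y : V) : ‖p x - p y‖ ≤ ‖x - y‖ := by
  have h1 := (h.norm_sub_sq_le_inner x y).trans (real_inner_le_norm _ _)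
  by_contra! hlt
  have h0 : 0 < ‖p x - p y‖ := (norm_nonneg _).trans_lt hlt
  nlinarith

lemma lipschitzWith (h : IsNearestPointMap K p) : LipschitzWith 1 p :=
  LipschitzWith.of_dist_le_mul fun x y => by
    rw [dist_eq_norm, dist_eq_norm, NNReal.coe_one, one_mul]; exact h.norm_sub_le x y

lemma eq_of_inner_le (h : IsNearestPointMap K p) {x q : V} (hq : q ∈ K)
    (hi : ∀ w ∈ K, inner ℝ (x - q) (w - q) ≤ 0) : p x = q := by
  have h1 := (h x).2 q hq
  have h2 := hi (p x) (h x).1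
  have h3 : inner ℝ (p x - q) (p x - q) = inner ℝ (x - p x) (q - p x) + inner ℝ (x - q) (p x - q) := by
    rw [← neg_sub (p x) q, inner_neg_right, neg_add_eq_sub, ← inner_sub_left]
    congr 1
    abel
  have h4 : inner ℝ (p x - q) (p x - q) ≤ 0 := by linarith
  exact sub_eq_zero.1 (real_inner_self_nonpos.1 h4)

lemma norm_sub_le_of_mem (h : IsNearestPointMap K p) (x : V) {k : V} (hk : k ∈ K) :
    ‖x - p x‖ ≤ ‖x - k‖ := by
  have h1 := (h x).2 k hk
  have h2 : ‖x - k‖ ^ 2 = ‖x - p x‖ ^ 2 - 2 * inner ℝ (x - p x) (k - p x) + ‖k - p x‖ ^ 2 := by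
    rw [← norm_sub_sq_real]
    congr 2
    abel
  have h3 : ‖x - p x‖ ^ 2 ≤ ‖x - k‖ ^ 2 := by nlinarith [sq_nonneg ‖k - p x‖]
  exact le_of_sq_le_sq h3 (norm_nonneg _)

lemma apply_ray (h : IsNearestPointMap K p) (x : V) {t : ℝ} (ht : 0 ≤ t) :
    p (p x + t • (x - p x)) = p x := by
  refine h.eq_of_inner_le (h x).1 fun w hw => ?_
  rw [add_sub_cancel_left, real_inner_smul_left]
  exact mul_nonpos_of_nonneg_of_nonpos ht ((h x).2 w hw)

lemma cthickening_eq (h : IsNearestPointMap K p) (hK : IsCompact K) {t : ℝ} (ht : 0 ≤ t) :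
    Metric.cthickening t K = {x | ‖x - p x‖ ≤ t} := by
  rw [hK.cthickening_eq_biUnion_closedBall ht]
  ext x
  simp only [mem_iUnion, Metric.mem_closedBall, dist_eq_norm, exists_prop, mem_ofPred_eq]
  exact ⟨fun ⟨k, hk, hx⟩ => (h.norm_sub_le_of_mem x hk).trans hx, fun hx => ⟨p x, (h x).1, hx⟩⟩

lemma infDist_eq (h : IsNearestPointMap K p) (x : V) : Metric.infDist x K = ‖x - p x‖ := by
  refine le_antisymm ?_ ?_
  · rw [← dist_eq_norm]; exact Metric.infDist_le_dist_of_mem (h x).1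
  · refine (Metric.le_infDist ⟨p x, (h x).1⟩).2 fun k hk => ?_
    rw [dist_eq_norm]; exact h.norm_sub_le_of_mem x hk

/-- Points of the ray from `p x` through `x` keep the foot `p x`, so the ray map with `t⁻¹` inverts
the one with `t`. -/
lemma image_ray_cthickening (h : IsNearestPointMap K p) (hK : IsCompact K) {t : ℝ} (ht : 0 < t) :
    (fun x => p x + t • (x - p x)) '' Metric.cthickening 1 K = Metric.cthickening t K := by
  rw [h.cthickening_eq hK zero_le_one, h.cthickening_eq hK ht.le]
  ext y
  constructor
  · rintro ⟨x, hx, rfl⟩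
    simp only [mem_ofPred_eq, h.apply_ray x ht.le, add_sub_cancel_left, norm_smul,
      Real.norm_of_nonneg ht.le]
    exact mul_le_of_le_one_right ht.le hx
  · intro hy
    refine ⟨p y + t⁻¹ • (y - p y), ?_, ?_⟩
    · simp only [mem_ofPred_eq, h.apply_ray y (inv_nonneg.2 ht.le), add_sub_cancel_left, norm_smul,
        Real.norm_of_nonneg (inv_nonneg.2 ht.le)]
      rw [inv_mul_le_iff₀ ht, mul_one]
      exact hy
    · simp only [h.apply_ray y (inv_nonneg.2 ht.le), add_sub_cancel_left, smul_smul,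
        mul_inv_cancel₀ ht.ne', one_smul, add_sub_cancel]

lemma injective_ray (h : IsNearestPointMap K p) {t : ℝ} (ht : 0 < t) :
    Function.Injective fun x => p x + t • (x - p x) := by
  intro x y hxy
  dsimp only at hxy
  have h1 := congrArg p hxy
  rw [h.apply_ray x ht.le, h.apply_ray y ht.le] at h1
  rw [h1, add_right_inj] at hxy
  exact sub_left_injective (smul_right_injective V ht.ne' hxy)

lemma lipschitzWith_ray (h : IsNearestPointMap K p) {t : ℝ} (ht : 0 ≤ t) :
    LipschitzWith (Real.toNNReal (1 + 2 * t)) fun x => p x + t • (x - p x) := by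
  refine LipschitzWith.of_dist_le_mul fun x y => ?_
  rw [dist_eq_norm, dist_eq_norm, Real.coe_toNNReal _ (by positivity)]
  have e : p x + t • (x - p x) - (p y + t • (y - p y)) =
      (p x - p y) + t • ((x - y) - (p x - p y)) := by module
  have h1 := h.norm_sub_le x y
  rw [e]
  calc _ ≤ ‖p x - p y‖ + ‖t • ((x - y) - (p x - p y))‖ := norm_add_le _ _
    _ ≤ ‖x - y‖ + t * (‖x - y‖ + ‖x - y‖) := by
        rw [norm_smul, Real.norm_of_nonneg ht]
        gcongr
        exact (_root_.norm_sub_le _ _).trans (by gcongr)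
    _ = _ := by ring

lemma norm_fderiv_sq_le (h : IsNearestPointMap K p) {x : V} {A : V →L[ℝ] V}
    (hA : HasFDerivAt p A x) (v : V) : ‖A v‖ ^ 2 ≤ inner ℝ v (A v) := by
  have ht := (hA.hasLineDerivAt v).tendsto_slope_zero
  refine le_of_tendsto_of_tendsto (ht.norm.pow 2) (tendsto_const_nhds.inner ht) ?_
  refine Filter.eventually_of_mem self_mem_nhdsWithin fun s hs => ?_
  have h1 := h.norm_sub_sq_le_inner (x + s • v) x
  rw [add_sub_cancel_left, real_inner_smul_left] at h1
  have hs2 : 0 < (s⁻¹) ^ 2 := by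
    have := inv_ne_zero (show s ≠ 0 from hs)
    positivity
  simp only [norm_smul, mul_pow, norm_inv, real_inner_smul_right, Real.norm_eq_abs, inv_pow, sq_abs]
  calc (s ^ 2)⁻¹ * ‖p (x + s • v) - p x‖ ^ 2
      ≤ (s ^ 2)⁻¹ * (s * inner ℝ v (p (x + s • v) - p x)) := by
        gcongr
    _ = _ := by
        have : s ≠ 0 := hs
        field_simp

end IsNearestPointMap

variable [FiniteDimensional ℝ V]

lemma exists_polynomial_det (A : V →ₗ[ℝ] V) :
    ∃ q : ℝ[X], q.natDegree ≤ Module.finrank ℝ V ∧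
      ∀ t : ℝ, LinearMap.det (A + t • (LinearMap.id - A)) = q.eval t := by
  classical
  let b := Module.finBasis ℝ V
  let M := LinearMap.toMatrix b b A
  refine ⟨Matrix.det ((Polynomial.X : ℝ[X]) • (1 - M).map Polynomial.C + M.map Polynomial.C), ?_, ?_⟩
  · simpa using Polynomial.natDegree_det_X_add_C_le (1 - M) M
  · intro t
    rw [← LinearMap.det_toMatrix b, ← Polynomial.coe_evalRingHom, RingHom.map_det]
    congr 1
    rw [map_add, map_smul, map_sub, LinearMap.toMatrix_id]
    ext i j
    simp only [Matrix.add_apply, Matrix.smul_apply, Matrix.map_apply, RingHom.mapMatrix_apply,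
      smul_eq_mul, map_add, Polynomial.coe_evalRingHom, Polynomial.eval_C]
    rw [Polynomial.eval_mul, Polynomial.eval_X, Polynomial.eval_C, add_comm]

/-- For `s > 0` and `v ≠ 0`, pairing `A v + s (v - A v)` with `v` gives `(1 - s) ⟨v, A v⟩ + s ‖v‖ ^
2 > 0`, since `0 ≤ ⟨v, A v⟩ ≤ ‖v‖ ^ 2`. So the determinant never vanishes on `(0, ∞)`, and it equals
`1` at `s = 1`. -/
lemma det_pos_of_norm_sq_le_inner {A : V →ₗ[ℝ] V} (hA : ∀ v, ‖A v‖ ^ 2 ≤ inner ℝ v (A v))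
    {t : ℝ} (ht : 0 < t) : 0 < LinearMap.det (A + t • (LinearMap.id - A)) := by
  obtain ⟨q, -, hq⟩ := exists_polynomial_det A
  have hne : ∀ s : ℝ, 0 < s → q.eval s ≠ 0 := by
    intro s hs h0
    rw [← hq] at h0
    obtain ⟨v, hv, hv0⟩ := (Submodule.ne_bot_iff _).1 (LinearMap.bot_lt_ker_of_det_eq_zero h0).ne'
    rw [LinearMap.mem_ker] at hv
    have h1 := congrArg (inner ℝ v) hv
    simp only [LinearMap.add_apply, LinearMap.smul_apply, LinearMap.sub_apply, LinearMap.id_apply,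
      inner_add_right, real_inner_smul_right, inner_sub_right, inner_zero_right,
      real_inner_self_eq_norm_sq] at h1
    have h2 := hA v
    have h3 := real_inner_le_norm v (A v)
    have hvpos : 0 < ‖v‖ := norm_pos_iff.2 hv0
    have h4 : ‖A v‖ ≤ ‖v‖ := by
      by_contra! hlt
      nlinarith
    have h5 : inner ℝ v (A v) ≤ ‖v‖ ^ 2 := by nlinarith
    have h6 : 0 ≤ inner ℝ v (A v) := (sq_nonneg _).trans h2
    rcases le_total s 1 with hs1 | hs1
    · nlinarith [mul_nonneg (sub_nonneg.2 hs1) h6, mul_pos hs (pow_pos hvpos 2)]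
    · nlinarith [mul_nonneg (sub_nonneg.2 hs1) (sub_nonneg.2 h5), pow_pos hvpos 2]
  have h1 : q.eval 1 = 1 := by
    rw [← hq, one_smul, add_sub_cancel, LinearMap.det_id]
  rw [hq]
  by_contra! hle
  obtain ⟨s, hs, hs0⟩ := isPreconnected_Ioi.intermediate_value (mem_Ioi.2 ht)
    (mem_Ioi.2 zero_lt_one) (f := fun s => q.eval s) q.continuous.continuousOn
    (show (0 : ℝ) ∈ Icc (q.eval t) (q.eval 1) from ⟨hle, by rw [h1]; exact zero_le_one⟩)
  exact hne s hs hs0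

variable [MeasurableSpace V] [BorelSpace V] (μ : Measure V) [μ.IsAddHaarMeasure]

lemma addHaar_image_eq_zero_of_lipschitzWith {f : V → V} {C : NNReal} (hf : LipschitzWith C f)
    {s : Set V} (hs : μ s = 0) : μ (f '' s) = 0 := by
  set d := Module.finrank ℝ V
  have h1 : (μH[d] : Measure V) s = 0 :=
    Measure.absolutelyContinuous_isAddHaarMeasure (μH[d]) μ hs
  refine Measure.absolutelyContinuous_isAddHaarMeasure μ (μH[d]) ?_
  have := hf.hausdorffMeasure_image_le (d := d) (by positivity) s
  rw [h1, mul_zero] at this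
  exact le_antisymm this zero_le

/-- The volume of a parallel body is an integral of a positive polynomial of the radius. -/
lemma measureReal_cthickening_eq_integral {K : Set V} {p : V → V} (h : IsNearestPointMap K p)
    (hK : IsCompact K) {t : ℝ} (ht : 0 < t) :
    IntegrableOn (fun x => LinearMap.det ((fderiv ℝ p x : V →ₗ[ℝ] V) +
      t • (LinearMap.id - (fderiv ℝ p x : V →ₗ[ℝ] V))))
      (Metric.cthickening 1 K ∩ {x | DifferentiableAt ℝ p x}) μ ∧
    μ.real (Metric.cthickening t K) =
      ∫ x in Metric.cthickening 1 K ∩ {x | DifferentiableAt ℝ p x},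
        LinearMap.det ((fderiv ℝ p x : V →ₗ[ℝ] V) +
          t • (LinearMap.id - (fderiv ℝ p x : V →ₗ[ℝ] V))) ∂μ := by
  set s := Metric.cthickening 1 K ∩ {x | DifferentiableAt ℝ p x} with hs
  set T : V → V := fun x => p x + t • (x - p x) with hT
  set T' : V → V →L[ℝ] V := fun x =>
    fderiv ℝ p x + t • (ContinuousLinearMap.id ℝ V - fderiv ℝ p x) with hT'
  have hdet : ∀ x ∈ s, |(T' x).det| = LinearMap.det ((fderiv ℝ p x : V →ₗ[ℝ] V) +
      t • (LinearMap.id - (fderiv ℝ p x : V →ₗ[ℝ] V))) := by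
    intro x hx
    rw [abs_of_pos]
    · rfl
    · exact det_pos_of_norm_sq_le_inner (A := (fderiv ℝ p x : V →ₗ[ℝ] V))
        (h.norm_fderiv_sq_le hx.2.hasFDerivAt) ht
  have hsm : MeasurableSet s :=
    Metric.isClosed_cthickening.measurableSet.inter (measurableSet_of_differentiableAt ℝ p)
  have hd : ∀ x ∈ s, HasFDerivWithinAt T (T' x) s x := by
    intro x hx
    have hp : HasFDerivAt p (fderiv ℝ p x) x := hx.2.hasFDerivAt
    exact (hp.add (((hasFDerivAt_id x).sub hp).const_smul t)).hasFDerivWithinAt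
  have hinj : InjOn T s := (h.injective_ray ht).injOn
  have hfin : μ (Metric.cthickening t K) ≠ ∞ := hK.cthickening.measure_ne_top
  have hsub : T '' s ⊆ Metric.cthickening t K := by
    rw [← h.image_ray_cthickening hK ht]
    exact image_mono inter_subset_left
  have himg : μ (Metric.cthickening t K) = μ (T '' s) := by
    refine le_antisymm ?_ (measure_mono hsub)
    -- By Rademacher's theorem `p` is differentiable almost everywhere, and the Lipschitz map `T`
    -- sends the exceptional null set to a null set.
    have hnull : μ (T '' {x | ¬ DifferentiableAt ℝ p x}) = 0 :=
      addHaar_image_eq_zero_of_lipschitzWith μ (h.lipschitzWith_ray ht.le)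
        h.lipschitzWith.ae_differentiableAt
    calc μ (Metric.cthickening t K) ≤ μ (T '' s ∪ T '' {x | ¬ DifferentiableAt ℝ p x}) := by
          rw [← h.image_ray_cthickening hK ht, ← image_union]
          refine measure_mono (image_mono fun x hx => ?_)
          by_cases hx' : DifferentiableAt ℝ p x
          · exact Or.inl ⟨hx, hx'⟩
          · exact Or.inr hx'
      _ ≤ _ := measure_union_le _ _
      _ = _ := by rw [hnull, add_zero]
  have hint : IntegrableOn (fun _ => (1 : ℝ)) (T '' s) μ :=
    integrableOn_const (by rw [← himg]; exact hfin)
  constructor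
  · have := (integrableOn_image_iff_integrableOn_abs_det_fderiv_smul μ hsm hd hinj _).1 hint
    refine this.congr_fun (fun x hx => ?_) hsm
    simp only [smul_eq_mul, mul_one]
    exact hdet x hx
  · have := integral_image_eq_integral_abs_det_fderiv_smul μ hsm hd hinj fun _ => (1 : ℝ)
    rw [setIntegral_const, smul_eq_mul, mul_one] at this
    rw [measureReal_def, himg, ← measureReal_def, this]
    refine setIntegral_congr_fun hsm fun x hx => ?_
    simp only [smul_eq_mul, mul_one]
    exact hdet x hx

/-- The Steiner formula. -/
theorem exists_polynomial_measureReal_cthickening {K : Set V} (hK : Convex ℝ K)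
    (hKc : IsCompact K) (hKn : K.Nonempty) :
    ∃ q : ℝ[X], q.natDegree ≤ Module.finrank ℝ V ∧
      ∀ t : ℝ, 0 ≤ t → μ.real (Metric.cthickening t K) = q.eval t := by
  obtain ⟨p, h⟩ := exists_isNearestPointMap hK hKc.isComplete hKn
  set d := Module.finrank ℝ V with hd
  set S : Finset ℕ := Finset.range (d + 1) with hS
  set v : ℕ → ℝ := fun j => j + 1 with hv
  have hvpos : ∀ j, 0 < v j := fun j => by positivity
  have hvinj : InjOn v S := fun i _ j _ hij => by simpa [hv] using hij
  -- Interpolation at `d + 1` positive radii: the determinant is, at each point, a polynomial in `t`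
  -- of degree at most `d`, hence reproduced by its values at the nodes. This commutes with
  -- integration without treating its coefficients as integrable functions.
  set q := Lagrange.interpolate S v fun j => μ.real (Metric.cthickening (v j) K) with hq
  have hpos : ∀ t : ℝ, 0 < t → μ.real (Metric.cthickening t K) = q.eval t := by
    intro t ht
    have hqt : q.eval t = ∑ j ∈ S, μ.real (Metric.cthickening (v j) K) *
        (Lagrange.basis S v j).eval t := by
      rw [hq, Lagrange.interpolate_apply, Polynomial.eval_finsetSum]
      refine Finset.sum_congr rfl fun j _ => ?_
      rw [Polynomial.eval_mul, Polynomial.eval_C]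
    rw [hqt, (measureReal_cthickening_eq_integral μ h hKc ht).2]
    have hj := fun j => measureReal_cthickening_eq_integral μ h hKc (hvpos j)
    simp_rw [fun j => (hj j).2, ← integral_mul_const]
    rw [← integral_finsetSum _ fun j _ => (hj j).1.mul_const _]
    refine integral_congr_ae (ae_of_all _ fun x => ?_)
    obtain ⟨r, hr, hrt⟩ := exists_polynomial_det (fderiv ℝ p x : V →ₗ[ℝ] V)
    have hr' : r.degree < S.card := by
      rw [hS, Finset.card_range]
      exact lt_of_le_of_lt Polynomial.degree_le_natDegree (by exact_mod_cast Nat.lt_succ_of_le hr)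
    have := Lagrange.eq_interpolate hvinj hr'
    simp only [hrt]
    conv_lhs => rw [this]
    rw [Lagrange.interpolate_apply, Polynomial.eval_finsetSum]
    refine Finset.sum_congr rfl fun j _ => ?_
    rw [Polynomial.eval_mul, Polynomial.eval_C]
  refine ⟨q, ?_, fun t ht => ?_⟩
  · have := Lagrange.degree_interpolate_le (fun j => μ.real (Metric.cthickening (v j) K)) hvinj
    rw [hS, Finset.card_range] at this
    exact Polynomial.natDegree_le_of_degree_le this
  · rcases ht.eq_or_lt with rfl | ht
    -- At `t = 0` the ray map collapses to `p`, so the formula is obtained by letting the radius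
    -- tend to `0`.
    · have h1 : Filter.Tendsto (fun r => μ.real (Metric.cthickening r K)) (nhdsWithin 0 (Ioi 0))
          (nhds (μ.real (Metric.cthickening 0 K))) := by
        rw [Metric.cthickening_zero, hKc.isClosed.closure_eq]
        exact ((ENNReal.tendsto_toReal hKc.measure_ne_top).comp
          (tendsto_measure_cthickening_of_isCompact hKc)).mono_left nhdsWithin_le_nhds
      have h2 : Filter.Tendsto (fun r => μ.real (Metric.cthickening r K)) (nhdsWithin 0 (Ioi 0))
          (nhds (q.eval 0)) :=
        ((q.continuous.tendsto 0).mono_left nhdsWithin_le_nhds).congr'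
          (Filter.eventually_of_mem self_mem_nhdsWithin fun r hr => (hpos r hr).symm)
      exact tendsto_nhds_unique h1 h2
    · exact hpos t ht

lemma exists_isSteinerPolynomial {n : ℕ} {K : Set (EuclideanSpace ℝ (Fin n))} (hK : Convex ℝ K)
    (hKc : IsCompact K) (hKn : K.Nonempty) :
    ∃ q : ℝ[X], IsSteinerPolynomial K (Metric.closedBall 0 1) q ∧
      ∀ t : ℝ, 0 ≤ t → volume.real (Metric.cthickening t K) = q.eval t := by
  obtain ⟨q, hq, h⟩ := exists_polynomial_measureReal_cthickening volume hK hKc hKn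
  rw [finrank_euclideanSpace_fin] at hq
  refine ⟨q, ⟨hq, fun t ht => ?_⟩, h⟩
  rw [smul_unitClosedBall_of_nonneg ht, hKc.add_closedBall_zero ht, h t ht]

end Steiner

/-! ### Hadwiger's formula and the upper bounds for the classical Wills functional. -/

section GaussianCase

local notation "𝔼" n => EuclideanSpace ℝ (Fin n)

/-- The function `t ↦ π t ^ 2` which makes the generalized Wills functional the classical one. -/
noncomputable def sqProfile (t : ℝ) : EReal := ((Real.pi * t ^ 2 : ℝ) : EReal)

lemma isConvexIncreasing_sqProfile : IsConvexIncreasing sqProfile where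
  ne_bot t _ := EReal.coe_ne_bot _
  convex s t a b hs ht ha hb hab := by
    have hp := Real.pi_pos
    simp only [sqProfile]
    rw [← EReal.coe_mul, ← EReal.coe_mul, ← EReal.coe_add, EReal.coe_le_coe_iff]
    have h : (a * s + b * t) ^ 2 ≤ a * s ^ 2 + b * t ^ 2 := by
      obtain rfl : b = 1 - a := by linarith
      nlinarith [mul_nonneg (mul_nonneg ha hb) (sq_nonneg (s - t))]
    calc Real.pi * (a * s + b * t) ^ 2 ≤ Real.pi * (a * s ^ 2 + b * t ^ 2) := by gcongr
      _ = _ := by ring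
  continuousOn := by
    unfold sqProfile
    exact (continuous_coe_real_ereal.comp (by fun_prop)).continuousOn
  monotoneOn s hs t ht hst := by
    have hp := Real.pi_pos
    have hs' : (0 : ℝ) ≤ s := hs
    simp only [sqProfile]
    rw [EReal.coe_le_coe_iff]
    gcongr

lemma isStrictlyIncreasing_sqProfile : IsStrictlyIncreasing sqProfile where
  strictMonoOn s hs t ht hst := by
    have hp := Real.pi_pos
    have hs' : (0 : ℝ) ≤ s := hs.1
    simp only [sqProfile]
    rw [EReal.coe_lt_coe_iff]
    gcongr
  exists_pos := ⟨1, one_pos, EReal.coe_ne_top _⟩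

lemma sqProfile_zero : sqProfile 0 = 0 := by simp [sqProfile]

variable {n : ℕ} {K : Set (EuclideanSpace ℝ (Fin n))}

lemma convex_unitBall : Convex ℝ (Metric.closedBall (0 : 𝔼 n) 1) := convex_closedBall _ _

lemma zero_mem_interior_unitBall : (0 : 𝔼 n) ∈ interior (Metric.closedBall (0 : 𝔼 n) 1) :=
  mem_interior_iff_mem_nhds.2 (Metric.closedBall_mem_nhds _ one_pos)

lemma isCompact_unitBall : IsCompact (Metric.closedBall (0 : 𝔼 n) 1) := isCompact_closedBall _ _

lemma gauge_unitBall (x : 𝔼 n) : gauge (Metric.closedBall (0 : 𝔼 n) 1) x = ‖x‖ := by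
  rw [gauge_closedBall zero_le_one, div_one]

lemma relDist_unitBall (hK : IsCompact K) (hn : K.Nonempty) (x : 𝔼 n) :
    relDist (Metric.closedBall 0 1) x K = Metric.infDist x K := by
  obtain ⟨k, hk, h⟩ := exists_relDist_eq convex_unitBall zero_mem_interior_unitBall hK hn x
  refine le_antisymm ((Metric.le_infDist hn).2 fun y hy => ?_) ?_
  · rw [dist_eq_norm, ← gauge_unitBall]
    exact relDist_le hy x
  · rw [h, gauge_unitBall, ← dist_eq_norm]
    exact Metric.infDist_le_dist_of_mem hk

lemma kappa_eq (j : ℕ) : kappa j = √Real.pi ^ j / Real.Gamma ((j : ℝ) / 2 + 1) := by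
  rcases Nat.eq_zero_or_pos j with rfl | hj
  · have : Metric.closedBall (0 : EuclideanSpace ℝ (Fin 0)) 1 = univ :=
      eq_univ_of_forall fun x => by simp [Subsingleton.elim x 0]
    have h := (PiLp.volume_preserving_toLp (Fin 0)).measure_preimage
      (MeasurableSet.univ (α := EuclideanSpace ℝ (Fin 0))).nullMeasurableSet
    rw [preimage_univ, Measure.volume_pi_eq_dirac, Measure.dirac_apply_of_mem (mem_univ _)] at h
    simp [kappa, this, measureReal_def, ← h]
  · have : Nonempty (Fin j) := ⟨⟨0, hj⟩⟩
    have hG : 0 < Real.Gamma ((j : ℝ) / 2 + 1) := Real.Gamma_pos_of_pos (by positivity)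
    rw [kappa, measureReal_def, EuclideanSpace.volume_closedBall, ENNReal.ofReal_one, one_pow,
      one_mul, Fintype.card_fin, ENNReal.toReal_ofReal (by positivity)]

lemma wills_eq_sum {q : ℝ[X]} (hq : IsSteinerPolynomial K (Metric.closedBall 0 1) q) :
    wills K = ∑ j ∈ Finset.range (n + 1),
      q.coeff j * (Real.Gamma ((j : ℝ) / 2 + 1) / √Real.pi ^ j) := by
  rw [wills, ← Finset.sum_flip]
  refine Finset.sum_congr rfl fun i hi => ?_
  have hin : i ≤ n := Nat.lt_succ_iff.1 (Finset.mem_range.1 hi)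
  have hc : (n.choose i : ℝ) ≠ 0 := by exact_mod_cast (Nat.choose_pos hin).ne'
  rw [intrinsicVolume, Nat.sub_sub_self hin, quermassintegral_eq hq, kappa_eq, Nat.choose_symm hin,
    div_div_eq_mul_div]
  field_simp

/-- The value is `1 / kappa j`, the weight of the `j`-th Steiner coefficient in `wills_eq_sum`. -/
lemma integrableOn_exp_neg_mul_sqrt_pow (j : ℕ) :
    IntegrableOn (fun s : ℝ => Real.exp (-s) * √(s / Real.pi) ^ j) (Ioi 0) ∧
    ∫ s in Ioi (0 : ℝ), Real.exp (-s) * √(s / Real.pi) ^ j =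
      Real.Gamma ((j : ℝ) / 2 + 1) / √Real.pi ^ j := by
  have h0 : (0 : ℝ) < (j : ℝ) / 2 + 1 := by positivity
  have he : ∀ s ∈ Ioi (0 : ℝ), Real.exp (-s) * √(s / Real.pi) ^ j =
      (Real.exp (-s) * s ^ ((j : ℝ) / 2 + 1 - 1)) * (√Real.pi ^ j)⁻¹ := by
    intro s hs
    have hs0 : (0 : ℝ) ≤ s := le_of_lt hs
    rw [Real.sqrt_div hs0, div_pow, add_sub_cancel_right, Real.sqrt_eq_rpow s, ← Real.rpow_mul_natCast hs0,
      div_eq_mul_inv, mul_assoc, one_div_mul_eq_div]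
  constructor
  · refine IntegrableOn.congr_fun ?_ (fun s hs => (he s hs).symm) measurableSet_Ioi
    exact (Real.GammaIntegral_convergent h0).mul_const _
  · rw [setIntegral_congr_fun measurableSet_Ioi he, integral_mul_const, ← Real.Gamma_eq_integral h0,
      div_eq_mul_inv _ (√Real.pi ^ j)]

/-- Hadwiger's integral formula for the Wills functional. -/
theorem genWills_sqProfile (hK : Convex ℝ K) (hKc : IsCompact K) (hKn : K.Nonempty) :
    0 ≤ wills K ∧
      genWills sqProfile K (Metric.closedBall 0 1) = ENNReal.ofReal (wills K) := by
  obtain ⟨q, hq, hvol⟩ := exists_isSteinerPolynomial hK hKc hKn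
  have hp := Real.pi_pos
  set f : ℝ → ℝ := fun s => Real.exp (-s) * q.eval √(s / Real.pi) with hf
  have hfe : ∀ s, f s = ∑ j ∈ Finset.range (n + 1),
      q.coeff j * (Real.exp (-s) * √(s / Real.pi) ^ j) := by
    intro s
    simp only [hf]
    rw [Polynomial.eval_eq_sum_range' (Nat.lt_succ_of_le hq.1), Finset.mul_sum]
    exact Finset.sum_congr rfl fun j _ => by ring
  have hf0 : ∀ s, 0 ≤ f s := fun s => by
    simp only [hf]
    rw [← hvol _ (Real.sqrt_nonneg _)]
    positivity
  have hfi : IntegrableOn f (Ioi 0) := by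
    rw [funext hfe]
    exact integrable_finsetSum _ fun j _ => (integrableOn_exp_neg_mul_sqrt_pow j).1.const_mul _
  have hwills : wills K = ∫ s in Ioi (0 : ℝ), f s := by
    rw [wills_eq_sum hq, funext hfe, integral_finsetSum _ fun j _ =>
      (integrableOn_exp_neg_mul_sqrt_pow j).1.const_mul _]
    refine Finset.sum_congr rfl fun j _ => ?_
    rw [integral_const_mul, (integrableOn_exp_neg_mul_sqrt_pow j).2]
  refine ⟨hwills ▸ integral_nonneg hf0, ?_⟩
  have hmeas : Measurable fun x : 𝔼 n => sqProfile (Metric.infDist x K) :=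
    measurable_comp_of_monotoneOn isConvexIncreasing_sqProfile.monotoneOn
      (Metric.continuous_infDist_pt K).measurable (fun x => Metric.infDist_nonneg)
  rw [hwills, ofReal_integral_eq_lintegral_ofReal hfi (ae_of_all _ hf0), genWills]
  simp_rw [relDist_unitBall hKc hKn]
  rw [lintegral_exp_neg hmeas (fun x => EReal.coe_ne_bot _), ← lintegral_indicator measurableSet_Ioi]
  -- The sublevel set is empty for `s < 0` and is the parallel body of radius `√(s / π)` for `s >
  -- 0`; the single level `s = 0` is discarded.
  have hae : ∀ᵐ s : ℝ, s ≠ 0 := by simp [ae_iff, measure_singleton]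
  refine lintegral_congr_ae (hae.mono fun s hs0 => ?_)
  dsimp only
  rcases lt_or_gt_of_ne hs0 with hs | hs
  · have : {x : 𝔼 n | sqProfile (Metric.infDist x K) ≤ s} = ∅ := by
      refine eq_empty_of_forall_notMem fun x hx => ?_
      have h1 : Real.pi * Metric.infDist x K ^ 2 ≤ s := EReal.coe_le_coe_iff.1 hx
      have : 0 ≤ Real.pi * Metric.infDist x K ^ 2 := by positivity
      linarith
    rw [this, measure_empty, mul_zero, indicator_of_notMem (by simpa using hs.le)]
  · have : {x : 𝔼 n | sqProfile (Metric.infDist x K) ≤ s} =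
        Metric.cthickening √(s / Real.pi) K := by
      obtain ⟨p, h⟩ := exists_isNearestPointMap hK hKc.isComplete hKn
      rw [h.cthickening_eq hKc (Real.sqrt_nonneg _)]
      ext x
      simp only [mem_ofPred_eq, sqProfile, EReal.coe_le_coe_iff]
      rw [← h.infDist_eq, Real.le_sqrt Metric.infDist_nonneg (by positivity),
        le_div_iff₀' hp]
    rw [this, indicator_of_mem (mem_Ioi.2 hs), hf, ENNReal.ofReal_mul (Real.exp_pos _).le,
      ← hvol _ (Real.sqrt_nonneg _), ofReal_measureReal hKc.cthickening.measure_ne_top]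

lemma lintegral_exp_neg_mul_norm_sq {b : ℝ} (hb : 0 < b) :
    ∫⁻ x : 𝔼 n, ENNReal.ofReal (Real.exp (-b * ‖x‖ ^ 2)) =
      ENNReal.ofReal ((Real.pi / b) ^ ((n : ℝ) / 2)) := by
  have h := GaussianFourier.integral_rexp_neg_mul_sq_norm (V := 𝔼 n) hb
  rw [finrank_euclideanSpace_fin] at h
  have hi : Integrable fun x : 𝔼 n => Real.exp (-b * ‖x‖ ^ 2) := by
    -- A non-integrable function would have integral `0` by convention, against the positive value
    -- in `h`.
    by_contra hi
    rw [integral_undef hi] at h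
    have : 0 < (Real.pi / b) ^ ((n : ℝ) / 2) := by have := Real.pi_pos; positivity
    exact this.ne h
  rw [← h, ofReal_integral_eq_lintegral_ofReal hi (ae_of_all _ fun x => (Real.exp_pos _).le)]

lemma bddAbove_sublevel_sqProfile (s : ℝ) : BddAbove {t : ℝ | 0 ≤ t ∧ sqProfile t ≤ s} :=
  isConvexIncreasing_sqProfile.bddAbove_sublevel isStrictlyIncreasing_sqProfile s

lemma moment_sqProfile_mul :
    moment sqProfile n * volume (Metric.closedBall (0 : 𝔼 n) 1) = 1 := by
  rw [← lintegral_exp_neg_gauge isConvexIncreasing_sqProfile.monotoneOn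
    isConvexIncreasing_sqProfile.ne_bot bddAbove_sublevel_sqProfile convex_unitBall
    zero_mem_interior_unitBall isCompact_unitBall]
  have h := lintegral_exp_neg_mul_norm_sq (n := n) Real.pi_pos
  rw [div_self Real.pi_ne_zero, Real.one_rpow, ENNReal.ofReal_one] at h
  rw [← h]
  refine lintegral_congr fun x => ?_
  rw [gauge_unitBall, sqProfile, ← EReal.coe_neg, EReal.exp_coe, neg_mul]

lemma two_mul_sqProfile (t : ℝ) : 2 * sqProfile t = ((2 * Real.pi * t ^ 2 : ℝ) : EReal) := by
  rw [mul_assoc, EReal.coe_mul]; rfl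

/-- This is `∫ exp (-2π|x|²) = 2 ^ (-n / 2)`, the factor that turns `4 ^ n` into `8 ^ (n / 2)`. -/
lemma moment_two_mul_sqProfile_mul :
    moment (fun t => 2 * sqProfile t) n * volume (Metric.closedBall (0 : 𝔼 n) 1) =
      ENNReal.ofReal ((1 / 2 : ℝ) ^ ((n : ℝ) / 2)) := by
  rw [← lintegral_exp_neg_gauge (u := fun t => 2 * sqProfile t) ?_
    (fun t ht => two_mul_ereal_ne_bot (EReal.coe_ne_bot _)) ?_
    convex_unitBall zero_mem_interior_unitBall isCompact_unitBall]
  · have h := lintegral_exp_neg_mul_norm_sq (n := n) (b := 2 * Real.pi)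
      (by have := Real.pi_pos; positivity)
    rw [div_mul_cancel_right₀ Real.pi_ne_zero, ← one_div] at h
    rw [← h]
    refine lintegral_congr fun x => ?_
    rw [gauge_unitBall, two_mul_sqProfile, ← EReal.coe_neg, EReal.exp_coe, neg_mul]
  · intro s hs t ht hst
    have := isConvexIncreasing_sqProfile.monotoneOn hs ht hst
    dsimp only
    gcongr
  · intro s
    refine (bddAbove_sublevel_sqProfile (s / 2)).mono fun t ht => ?_
    exact ⟨ht.1, le_half_of_two_mul_le ht.2⟩

/-- Substitute `x = -√(2π) z`: the exponent `|x|² / 2` becomes `π |z|²`, and the Jacobian cancels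
the normalization. The sign accounts for the reflected body `-K`. -/
lemma gaussian_add_smul (hK : IsCompact K) (y : 𝔼 n) :
    gaussian n ({y} + √(2 * Real.pi) • K) =
      gaugeMeasure sqProfile (Metric.closedBall 0 1) ({-((√(2 * Real.pi))⁻¹ • y)} - K) := by
  have hp := Real.pi_pos
  set r := √(2 * Real.pi) with hr
  have hr0 : 0 < r := Real.sqrt_pos.2 (by positivity)
  have hr2 : r ^ 2 = 2 * Real.pi := Real.sq_sqrt (by positivity)
  have hrn : (2 * Real.pi) ^ ((n : ℝ) / 2) = r ^ n := by
    rw [hr, Real.sqrt_eq_rpow, ← Real.rpow_mul_natCast (by positivity), one_div_mul_eq_div]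
  set A : Set (𝔼 n) := {y} + r • K with hA
  have hAm : MeasurableSet A := (isCompact_singleton.add (hK.smul r)).measurableSet
  have hmem : ∀ z : 𝔼 n, r • -z ∈ A ↔ z ∈ ({-(r⁻¹ • y)} : Set (𝔼 n)) - K := by
    intro z
    rw [mem_singleton_sub_iff, hA, singleton_add, mem_image]
    constructor
    · rintro ⟨_, ⟨k, hk, rfl⟩, h⟩
      have : k = -(r⁻¹ • y) - z := by
        have h2 := congrArg (fun v => r⁻¹ • v) h
        simp only [smul_add, smul_smul, inv_mul_cancel₀ hr0.ne', one_smul] at h2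
        rw [sub_eq_add_neg, ← h2]; abel
      rwa [← this]
    · intro h
      refine ⟨r • (-(r⁻¹ • y) - z), ⟨_, h, rfl⟩, ?_⟩
      simp only [smul_sub, smul_neg, smul_smul, mul_inv_cancel₀ hr0.ne', one_smul]
      abel
  have h1 := lintegral_comp_smul (A.indicator fun x : 𝔼 n => ENNReal.ofReal
    (1 / (2 * Real.pi) ^ ((n : ℝ) / 2) * Real.exp (-‖x‖ ^ 2 / 2))) hr0
  rw [lintegral_indicator hAm, ← withDensity_apply _ hAm] at h1
  change _ = _ * gaussian n A at h1
  have h2 : gaussian n A = ENNReal.ofReal (r ^ n) * (ENNReal.ofReal (r ^ n)⁻¹ * gaussian n A) := by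
    rw [← mul_assoc, ← ENNReal.ofReal_mul (by positivity), mul_inv_cancel₀ (by positivity),
      ENNReal.ofReal_one, one_mul]
  rw [h2, ← h1, gaugeMeasure_sub hK, ← lintegral_const_mul' _ _ ENNReal.ofReal_ne_top,
    ← lintegral_neg_eq_self, ← lintegral_indicator (measurableSet_sub hK _)]
  refine lintegral_congr fun z => ?_
  by_cases hz : r • -z ∈ A
  · rw [indicator_of_mem hz, indicator_of_mem ((hmem z).1 hz), ← ENNReal.ofReal_mul (by positivity),
      hrn, ← mul_assoc, mul_one_div_cancel (by positivity), one_mul, gauge_unitBall, sqProfile,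
      ← EReal.coe_neg, EReal.exp_coe, norm_smul, norm_neg, Real.norm_of_nonneg hr0.le, mul_pow, hr2]
    congr 2
    ring
  · rw [indicator_of_notMem hz, indicator_of_notMem ((hmem z).not.1 hz), mul_zero]

lemma four_pow_mul_half_rpow (n : ℕ) :
    (4 : ℝ) ^ n * (1 / 2 : ℝ) ^ ((n : ℝ) / 2) = (8 : ℝ) ^ ((n : ℝ) / 2) := by
  have h : (4 : ℝ) ^ n = (16 : ℝ) ^ ((n : ℝ) / 2) := by
    rw [show (16 : ℝ) = 4 ^ (2 : ℝ) by norm_num, ← Real.rpow_mul (by norm_num),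
      mul_div_cancel₀ _ two_ne_zero, Real.rpow_natCast]
  rw [h, ← Real.mul_rpow (by norm_num) (by norm_num)]
  norm_num

/-- Both upper bounds for the Wills functional, at a single translate. -/
lemma wills_mul_gaussian_le (hK : Convex ℝ K) (hKc : IsCompact K) (hKn : K.Nonempty) (y : 𝔼 n) :
    wills K * (gaussian n).real ({y} + √(2 * Real.pi) • K) ≤
        ((2 * n).choose n : ℝ) * volume.real K ∧
      wills K * (gaussian n).real ({y} + √(2 * Real.pi) • K) ≤
        (8 : ℝ) ^ ((n : ℝ) / 2) * volume.real K := by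
  obtain ⟨hw0, hw⟩ := genWills_sqProfile hK hKc hKn
  have hKf : volume K ≠ ∞ := hKc.measure_ne_top
  have h1 := genWills_mul_gaugeMeasure_le_choose isConvexIncreasing_sqProfile
    bddAbove_sublevel_sqProfile hK hKc hKn convex_unitBall zero_mem_interior_unitBall
    isCompact_unitBall (c := 0) sqProfile_zero (-((√(2 * Real.pi))⁻¹ • y))
  have h2 := genWills_mul_gaugeMeasure_le_pow isConvexIncreasing_sqProfile
    bddAbove_sublevel_sqProfile hK hKc hKn convex_unitBall zero_mem_interior_unitBall
    isCompact_unitBall (-((√(2 * Real.pi))⁻¹ • y))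
  rw [← gaussian_add_smul hKc, hw] at h1 h2
  rw [mul_assoc, mul_left_comm (moment _ _), moment_sqProfile_mul, sqProfile_zero, neg_zero,
    EReal.exp_zero, mul_one, mul_one] at h1
  rw [mul_assoc, mul_left_comm (moment _ _), moment_two_mul_sqProfile_mul] at h2
  have hl : (ENNReal.ofReal (wills K) * gaussian n ({y} + √(2 * Real.pi) • K)).toReal =
      wills K * (gaussian n).real ({y} + √(2 * Real.pi) • K) := by
    rw [ENNReal.toReal_mul, ENNReal.toReal_ofReal hw0, measureReal_def]
  constructor
  · have := ENNReal.toReal_mono (by finiteness) h1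
    rwa [hl, ENNReal.toReal_mul, ENNReal.toReal_natCast] at this
  · have := ENNReal.toReal_mono (by finiteness) h2
    rw [hl, ENNReal.toReal_mul, ENNReal.toReal_mul, ENNReal.toReal_ofReal (by positivity),
      ENNReal.toReal_pow, ENNReal.toReal_ofNat, mul_comm (volume K).toReal,
      ← mul_assoc, four_pow_mul_half_rpow] at this
    exact this

lemma gaussian_real_le (hKc : IsCompact K) (y : 𝔼 n) :
    (gaussian n).real ({y} + √(2 * Real.pi) • K) ≤ volume.real K := by
  have h := gaugeMeasure_sub_le (E := Metric.closedBall 0 1) isConvexIncreasing_sqProfile hKc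
    (-((√(2 * Real.pi))⁻¹ • y))
  rw [← gaussian_add_smul hKc, sqProfile_zero, neg_zero, EReal.exp_zero, one_mul] at h
  exact ENNReal.toReal_mono hKc.measure_ne_top h

lemma iSup_gaussian_pos (hKc : IsCompact K) (hKi : (interior K).Nonempty) :
    0 < ⨆ y : 𝔼 n, (gaussian n).real ({y} + √(2 * Real.pi) • K) := by
  obtain ⟨y, hy⟩ := hKi
  have hp := Real.pi_pos
  have hr0 : 0 < √(2 * Real.pi) := Real.sqrt_pos.2 (by positivity)
  have h := gaugeMeasure_sub_pos isConvexIncreasing_sqProfile isStrictlyIncreasing_sqProfile hKc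
    convex_unitBall zero_mem_interior_unitBall hy
  have hb : BddAbove (range fun y : 𝔼 n => (gaussian n).real ({y} + √(2 * Real.pi) • K)) :=
    ⟨volume.real K, by rintro _ ⟨y, rfl⟩; exact gaussian_real_le hKc y⟩
  refine lt_of_lt_of_le ?_ (le_ciSup hb (-(√(2 * Real.pi) • y)))
  have he := gaussian_add_smul hKc (-(√(2 * Real.pi) • y))
  rw [smul_neg, neg_neg, smul_smul, inv_mul_cancel₀ hr0.ne', one_smul] at he
  refine ENNReal.toReal_pos ?_ ?_
  · rw [he]; exact h.ne'
  · rw [he]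
    refine ne_top_of_le_ne_top ?_ (gaugeMeasure_sub_le isConvexIncreasing_sqProfile hKc y)
    rw [sqProfile_zero, neg_zero, EReal.exp_zero, one_mul]
    exact hKc.measure_ne_top

lemma wills_le_div_iSup (hK : Convex ℝ K) (hKc : IsCompact K) (hKi : (interior K).Nonempty)
    {C : ℝ} (hC : ∀ y : 𝔼 n, wills K * (gaussian n).real ({y} + √(2 * Real.pi) • K) ≤
      C * volume.real K) :
    wills K ≤ C * volume.real K /
      ⨆ y : 𝔼 n, (gaussian n).real ({y} + √(2 * Real.pi) • K) := by
  rw [le_div_iff₀ (iSup_gaussian_pos hKc hKi),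
    Real.mul_iSup_of_nonneg (genWills_sqProfile hK hKc (hKi.mono interior_subset)).1]
  exact ciSup_le hC

end GaussianCase

/-- The case `n = 4` is `64 ≤ 70`. Afterwards the left side grows by `√8 ≤ 3` per step, and the
central binomial coefficient by `2 (2n + 1) / (n + 1) ≥ 3`. -/
lemma eight_rpow_half_le_choose {n : ℕ} (hn : 4 ≤ n) :
    (8 : ℝ) ^ ((n : ℝ) / 2) ≤ ((2 * n).choose n : ℝ) := by
  induction n, hn using Nat.le_induction with
  | base =>
    rw [show ((4 : ℕ) : ℝ) / 2 = (2 : ℕ) by norm_num, Real.rpow_natCast]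
    norm_num [Nat.choose]
  | succ n hn ih =>
    have h8 : (8 : ℝ) ^ (1 / 2 : ℝ) ≤ 3 := by
      rw [← Real.sqrt_eq_rpow]
      exact Real.sqrt_le_iff.2 ⟨by norm_num, by norm_num⟩
    have hrec := Nat.succ_mul_centralBinom_succ n
    simp only [Nat.centralBinom_eq_two_mul_choose] at hrec
    have hrec' : ((n : ℝ) + 1) * ((2 * (n + 1)).choose (n + 1) : ℝ) =
        2 * (2 * n + 1) * ((2 * n).choose n : ℝ) := by exact_mod_cast hrec
    have hn' : (4 : ℝ) ≤ n := by exact_mod_cast hn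
    have hc0 : (0 : ℝ) ≤ ((2 * n).choose n : ℝ) := by positivity
    have h3 : 3 * ((2 * n).choose n : ℝ) ≤ ((2 * (n + 1)).choose (n + 1) : ℝ) := by
      refine le_of_mul_le_mul_left ?_ (show (0 : ℝ) < n + 1 by positivity)
      rw [hrec']
      nlinarith
    calc (8 : ℝ) ^ (((n + 1 : ℕ) : ℝ) / 2) = (8 : ℝ) ^ ((n : ℝ) / 2) * (8 : ℝ) ^ (1 / 2 : ℝ) := by
          rw [← Real.rpow_add (by norm_num)]
          congr 1
          push_cast
          ring
      _ ≤ ((2 * n).choose n : ℝ) * 3 := by gcongr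
      _ ≤ _ := by linarith

/-! ### Prékopa–Leindler for midpoints, and the lower bound. -/

section PrekopaLeindler

/-- The Brunn–Minkowski inequality on the line, for compact sets. -/
lemma volume_add_volume_le_of_isCompact {A B : Set ℝ} (hA : IsCompact A) (hB : IsCompact B)
    (hAn : A.Nonempty) (hBn : B.Nonempty) : volume A + volume B ≤ volume (A + B) := by
  obtain ⟨M, hM, hMmax⟩ := hA.exists_isGreatest hAn
  obtain ⟨m, hm, hmmin⟩ := hB.exists_isLeast hBn
  -- The translates `A + m` and `M + B` lie in `A + B` and meet only in `M + m`, by maximality of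
  -- `M` and minimality of `m`.
  have hdisj : AEDisjoint volume ((fun x => x + m) '' A) ((fun x => M + x) '' B) := by
    refine measure_mono_null (t := {M + m}) ?_ (measure_singleton _)
    rintro _ ⟨⟨a, ha, rfl⟩, ⟨b, hb, hab⟩⟩
    have h1 := hMmax ha
    have h2 := hmmin hb
    simp only [mem_singleton_iff] at hab ⊢
    linarith
  have hBm : NullMeasurableSet ((fun x => M + x) '' B) :=
    (hB.image (by fun_prop)).measurableSet.nullMeasurableSet
  calc volume A + volume B
      = volume ((fun x => x + m) '' A) + volume ((fun x => M + x) '' B) := by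
        rw [image_add_right, image_add_left, measure_preimage_add_right, measure_preimage_add]
    _ = volume ((fun x => x + m) '' A ∪ (fun x => M + x) '' B) :=
        (measure_union₀ hBm hdisj).symm
    _ ≤ volume (A + B) := by
        refine measure_mono (union_subset ?_ ?_)
        · rintro _ ⟨a, ha, rfl⟩; exact add_mem_add ha hm
        · rintro _ ⟨b, hb, rfl⟩; exact add_mem_add hM hb

/-- The Brunn–Minkowski inequality on the line, for the midpoint set. -/
lemma volume_add_volume_le_two_mul {A B C : Set ℝ} (hA : MeasurableSet A) (hB : MeasurableSet B)
    (hAn : A.Nonempty) (hBn : B.Nonempty)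
    (hC : ∀ x ∈ A, ∀ y ∈ B, (1 / 2 : ℝ) • x + (1 / 2 : ℝ) • y ∈ C) :
    volume A + volume B ≤ 2 * volume C := by
  -- Inner regularity with nonempty compact sets, because the compact case fails when one summand is
  -- empty.
  have hinner : ∀ S : Set ℝ, MeasurableSet S →
      volume S ≤ ⨆ (T : Set ℝ) (_ : IsCompact T ∧ T.Nonempty ∧ T ⊆ S), volume T := by
    intro S hS
    refine le_of_forall_lt fun r hr => ?_
    obtain ⟨T, hTS, hTc, hT⟩ := hS.exists_lt_isCompact hr
    refine hT.trans_le (le_iSup₂_of_le T ⟨hTc, ?_, hTS⟩ le_rfl)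
    exact nonempty_of_measure_ne_zero (zero_le.trans_lt hT).ne'
  obtain ⟨a, ha⟩ := hAn
  obtain ⟨b, hb⟩ := hBn
  refine (add_le_add (hinner A hA) (hinner B hB)).trans (ENNReal.biSup_add_biSup_le'
    ⟨{a}, isCompact_singleton, singleton_nonempty a, singleton_subset_iff.2 ha⟩
    ⟨{b}, isCompact_singleton, singleton_nonempty b, singleton_subset_iff.2 hb⟩ ?_)
  rintro S ⟨hSc, hSn, hSA⟩ T ⟨hTc, hTn, hTB⟩
  calc volume S + volume T ≤ volume (S + T) :=
        volume_add_volume_le_of_isCompact hSc hTc hSn hTn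
    _ ≤ volume ((2 : ℝ) • C) := by
        refine measure_mono ?_
        rintro _ ⟨s, hs, t, ht, rfl⟩
        refine ⟨_, hC s (hSA hs) t (hTB ht), ?_⟩
        simp only [smul_eq_mul]
        ring
    _ = 2 * volume C := by
        rw [Measure.addHaar_smul]
        simp

lemma lintegral_eq_lintegral_Ioo_volume {f : ℝ → ℝ≥0∞} (hf : Measurable f) (h1 : ∀ x, f x ≤ 1) :
    ∫⁻ x, f x = ∫⁻ t in Ioo (0 : ℝ) 1, volume {x | ENNReal.ofReal t < f x} := by
  have hfin : ∀ x, f x ≠ ∞ := fun x => ne_top_of_le_ne_top ENNReal.one_ne_top (h1 x)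
  have h := lintegral_eq_lintegral_meas_lt volume (f := fun x => (f x).toReal)
    (ae_of_all _ fun x => ENNReal.toReal_nonneg) hf.ennreal_toReal.aemeasurable
  simp_rw [fun x => ENNReal.ofReal_toReal (hfin x)] at h
  rw [h, ← Ioo_union_Ici_eq_Ioi one_pos, lintegral_union measurableSet_Ici
    (disjoint_left.2 fun x hx hx' => absurd hx.2 (not_lt.2 hx'))]
  have hz : ∫⁻ t in Ici (1 : ℝ), volume {x | t < (f x).toReal} = 0 := by
    rw [setLIntegral_congr_fun (g := fun _ => 0) measurableSet_Ici, lintegral_zero]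
    intro t ht
    have : {x | t < (f x).toReal} = ∅ := by
      refine eq_empty_of_forall_notMem fun x hx => ?_
      have := ENNReal.toReal_mono ENNReal.one_ne_top (h1 x)
      rw [ENNReal.toReal_one] at this
      exact absurd (hx.trans_le this) (not_lt.2 ht)
    simp only [this, measure_empty]
  rw [hz, add_zero]
  refine setLIntegral_congr_fun measurableSet_Ioo fun t ht => ?_
  congr 1
  ext x
  exact (ENNReal.ofReal_lt_iff_lt_toReal ht.1.le (hfin x)).symm

/-- With both suprema equal to `1`, the superlevel sets of `f` and `g` at any `t < 1` are nonempty,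
so one-dimensional Brunn–Minkowski applies level by level. Truncating `h` at `1` leaves only these
levels. -/
lemma lintegral_add_lintegral_le_of_iSup_eq_one {f g h : ℝ → ℝ≥0∞} (hf : Measurable f)
    (hg : Measurable g) (hh : Measurable h) (hf1 : ⨆ x, f x = 1) (hg1 : ⨆ x, g x = 1)
    (hfg : ∀ x y, f x * g y ≤ h ((1 / 2 : ℝ) • x + (1 / 2 : ℝ) • y) ^ 2) :
    (∫⁻ x, f x) + ∫⁻ x, g x ≤ 2 * ∫⁻ x, h x := by
  have hlevel : ∀ t ∈ Ioo (0 : ℝ) 1,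
      volume {x | ENNReal.ofReal t < f x} + volume {x | ENNReal.ofReal t < g x} ≤
        2 * volume {x | ENNReal.ofReal t < min (h x) 1} := by
    intro t ht
    have ht1 : ENNReal.ofReal t < 1 := by
      rw [← ENNReal.ofReal_one]; exact (ENNReal.ofReal_lt_ofReal_iff one_pos).2 ht.2
    obtain ⟨x₀, hx₀⟩ := lt_iSup_iff.1 (hf1 ▸ ht1)
    obtain ⟨y₀, hy₀⟩ := lt_iSup_iff.1 (hg1 ▸ ht1)
    refine volume_add_volume_le_two_mul (measurableSet_lt measurable_const hf)
      (measurableSet_lt measurable_const hg) ⟨x₀, hx₀⟩ ⟨y₀, hy₀⟩ fun x hx y hy => ?_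
    refine lt_min ?_ ht1
    have h1 : ENNReal.ofReal t ^ 2 < h ((1 / 2 : ℝ) • x + (1 / 2 : ℝ) • y) ^ 2 := by
      rw [pow_two]
      exact (ENNReal.mul_lt_mul hx hy).trans_le (hfg x y)
    exact lt_of_pow_lt_pow_left' 2 h1
  have hmf : Measurable fun t : ℝ => volume {x | ENNReal.ofReal t < f x} :=
    Antitone.measurable fun s t hst => measure_mono fun x hx =>
      (ENNReal.ofReal_le_ofReal hst).trans_lt hx
  calc (∫⁻ x, f x) + ∫⁻ x, g x
      = ∫⁻ t in Ioo (0 : ℝ) 1, (volume {x | ENNReal.ofReal t < f x} +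
          volume {x | ENNReal.ofReal t < g x}) := by
        rw [lintegral_add_left hmf,
          lintegral_eq_lintegral_Ioo_volume hf fun x => (le_iSup f x).trans hf1.le,
          lintegral_eq_lintegral_Ioo_volume hg fun x => (le_iSup g x).trans hg1.le]
    _ ≤ ∫⁻ t in Ioo (0 : ℝ) 1, 2 * volume {x | ENNReal.ofReal t < min (h x) 1} :=
        setLIntegral_mono' measurableSet_Ioo hlevel
    _ = 2 * ∫⁻ x, min (h x) 1 := by
        rw [lintegral_const_mul' _ _ (by finiteness),
          lintegral_eq_lintegral_Ioo_volume (hh.min measurable_const) fun x => min_le_right _ _]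
    _ ≤ 2 * ∫⁻ x, h x := by
        gcongr
        exact min_le_left _ _

lemma four_mul_mul_le_add_sq (p q : ℝ≥0∞) : 4 * (p * q) ≤ (p + q) ^ 2 := by
  wlog h : p ≤ q generalizing p q
  · rw [mul_comm p, add_comm]
    exact this q p (le_of_not_ge h)
  obtain ⟨d, rfl⟩ := exists_add_of_le h
  calc 4 * (p * (p + d)) ≤ 4 * (p * (p + d)) + d ^ 2 := le_self_add
    _ = _ := by ring

lemma lintegral_mul_lintegral_le_of_iSup_ne_top {f g h : ℝ → ℝ≥0∞} (hf : Measurable f)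
    (hg : Measurable g) (hh : Measurable h) (hfb : ⨆ x, f x ≠ ∞) (hgb : ⨆ x, g x ≠ ∞)
    (hfg : ∀ x y, f x * g y ≤ h ((1 / 2 : ℝ) • x + (1 / 2 : ℝ) • y) ^ 2) :
    (∫⁻ x, f x) * ∫⁻ x, g x ≤ (∫⁻ x, h x) ^ 2 := by
  set a := ⨆ x, f x with ha
  set b := ⨆ x, g x with hb
  rcases eq_or_ne a 0 with ha0 | ha0
  · have : ∀ x, f x = 0 := fun x => le_antisymm ((le_iSup f x).trans ha0.le) zero_le
    simp [this]
  rcases eq_or_ne b 0 with hb0 | hb0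
  · have : ∀ x, g x = 0 := fun x => le_antisymm ((le_iSup g x).trans hb0.le) zero_le
    simp [this]
  -- Dividing `f`, `g`, `h` by `a`, `b` and `√(a b)` preserves the hypothesis and makes both suprema
  -- `1`; the additive bound then becomes multiplicative by the arithmetic–geometric mean
  -- inequality.
  set c : ℝ≥0∞ := (a * b) ^ (1 / 2 : ℝ) with hc
  have hc2 : c ^ 2 = a * b := by
    rw [hc, ← ENNReal.rpow_natCast, ← ENNReal.rpow_mul]; norm_num
  have hab0 : a * b ≠ 0 := mul_ne_zero ha0 hb0
  have habt : a * b ≠ ∞ := ENNReal.mul_ne_top hfb hgb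
  have hmain := lintegral_add_lintegral_le_of_iSup_eq_one (f := fun x => a⁻¹ * f x)
    (g := fun x => b⁻¹ * g x) (h := fun x => c⁻¹ * h x) (hf.const_mul _) (hg.const_mul _)
    (hh.const_mul _) (by rw [← ENNReal.mul_iSup, ENNReal.inv_mul_cancel ha0 hfb])
    (by rw [← ENNReal.mul_iSup, ENNReal.inv_mul_cancel hb0 hgb]) (fun x y => by
      rw [mul_pow, ← ENNReal.inv_pow, hc2, ENNReal.mul_inv (Or.inl ha0) (Or.inl hfb),
        mul_mul_mul_comm]
      gcongr
      exact hfg x y)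
  rw [lintegral_const_mul _ hf, lintegral_const_mul _ hg, lintegral_const_mul _ hh] at hmain
  have h4 : 4 * ((a * b)⁻¹ * ((∫⁻ x, f x) * ∫⁻ x, g x)) ≤ 4 * ((a * b)⁻¹ * (∫⁻ x, h x) ^ 2) := by
    calc 4 * ((a * b)⁻¹ * ((∫⁻ x, f x) * ∫⁻ x, g x))
        = 4 * ((a⁻¹ * ∫⁻ x, f x) * (b⁻¹ * ∫⁻ x, g x)) := by
          rw [ENNReal.mul_inv (Or.inl ha0) (Or.inl hfb), mul_mul_mul_comm]
      _ ≤ (a⁻¹ * (∫⁻ x, f x) + b⁻¹ * ∫⁻ x, g x) ^ 2 := four_mul_mul_le_add_sq _ _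
      _ ≤ (2 * (c⁻¹ * ∫⁻ x, h x)) ^ 2 := by gcongr
      _ = _ := by
          rw [mul_pow, mul_pow, ← ENNReal.inv_pow, hc2]; norm_num
  rw [ENNReal.mul_le_mul_iff_right (by norm_num) (by norm_num),
    ENNReal.mul_le_mul_iff_right (ENNReal.inv_ne_zero.2 habt) (ENNReal.inv_ne_top.2 hab0)] at h4
  exact h4

lemma lintegral_eq_iSup_lintegral_min {X : Type*} [MeasurableSpace X] {μ : Measure X}
    {f : X → ℝ≥0∞} (hf : Measurable f) : ∫⁻ x, f x ∂μ = ⨆ N : ℕ, ∫⁻ x, min (f x) N ∂μ := by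
  rw [← lintegral_iSup (fun N => hf.min measurable_const) fun N M hNM x => by
    dsimp only
    gcongr]
  refine lintegral_congr fun x => ?_
  rw [← inf_iSup_eq, ENNReal.iSup_natCast, inf_top_eq]

/-- The Prékopa–Leindler inequality for midpoints holds on `X`. -/
def HasPrekopaLeindler (X : Type*) [AddCommGroup X] [Module ℝ X] [MeasureSpace X] : Prop :=
  ∀ f g h : X → ℝ≥0∞, Measurable f → Measurable g → Measurable h →
    (∀ x y, f x * g y ≤ h ((1 / 2 : ℝ) • x + (1 / 2 : ℝ) • y) ^ 2) →
    (∫⁻ x, f x) * ∫⁻ x, g x ≤ (∫⁻ x, h x) ^ 2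

lemma hasPrekopaLeindler_real : HasPrekopaLeindler ℝ := by
  intro f g h hf hg hh hfg
  -- Truncation makes `f` and `g` bounded and keeps the hypothesis; monotone convergence removes it.
  rw [lintegral_eq_iSup_lintegral_min hf, lintegral_eq_iSup_lintegral_min hg, ENNReal.iSup_mul]
  refine iSup_le fun N => ?_
  rw [ENNReal.mul_iSup]
  refine iSup_le fun M => ?_
  refine lintegral_mul_lintegral_le_of_iSup_ne_top (hf.min measurable_const)
    (hg.min measurable_const) hh ?_ ?_ fun x y => ?_
  · exact ne_top_of_le_ne_top (ENNReal.natCast_ne_top N) (iSup_le fun x => min_le_right _ _)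
  · exact ne_top_of_le_ne_top (ENNReal.natCast_ne_top M) (iSup_le fun x => min_le_right _ _)
  · exact (mul_le_mul' (min_le_left _ _) (min_le_left _ _)).trans (hfg x y)

variable {X Y : Type*} [AddCommGroup X] [Module ℝ X] [MeasureSpace X]
  [AddCommGroup Y] [Module ℝ Y] [MeasureSpace Y]

/-- Induction on dimension: the inequality on the fibres `Y` is exactly the hypothesis needed on `X`
for the fibre integrals. -/
lemma HasPrekopaLeindler.prod [SFinite (volume : Measure X)] [SFinite (volume : Measure Y)]
    (hX : HasPrekopaLeindler X) (hY : HasPrekopaLeindler Y) : HasPrekopaLeindler (X × Y) := by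
  intro f g h hf hg hh hfg
  rw [Measure.volume_eq_prod, lintegral_prod _ hf.aemeasurable, lintegral_prod _ hg.aemeasurable,
    lintegral_prod _ hh.aemeasurable]
  refine hX _ _ _ hf.lintegral_prod_right' hg.lintegral_prod_right' hh.lintegral_prod_right'
    fun x y => ?_
  exact hY _ _ _ (hf.comp measurable_prodMk_left) (hg.comp measurable_prodMk_left)
    (hh.comp measurable_prodMk_left) fun x' y' => hfg (x, x') (y, y')

lemma HasPrekopaLeindler.of_measurePreserving (hX : HasPrekopaLeindler X) {T : X → Y}
    (hT : MeasurePreserving T volume volume)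
    (hmid : ∀ x y, T ((1 / 2 : ℝ) • x + (1 / 2 : ℝ) • y) =
      (1 / 2 : ℝ) • T x + (1 / 2 : ℝ) • T y) : HasPrekopaLeindler Y := by
  intro f g h hf hg hh hfg
  rw [← hT.lintegral_comp hf, ← hT.lintegral_comp hg, ← hT.lintegral_comp hh]
  refine hX _ _ _ (hf.comp hT.measurable) (hg.comp hT.measurable) (hh.comp hT.measurable)
    fun x y => ?_
  simp only [hmid]
  exact hfg _ _

lemma hasPrekopaLeindler_pi (n : ℕ) : HasPrekopaLeindler (Fin n → ℝ) := by
  induction n with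
  | zero =>
    intro f g h hf hg hh hfg
    rw [Measure.volume_pi_eq_dirac 0, lintegral_dirac' _ hf, lintegral_dirac' _ hg,
      lintegral_dirac' _ hh]
    simpa using hfg 0 0
  | succ n ih =>
    refine (hasPrekopaLeindler_real.prod ih).of_measurePreserving
      (volume_preserving_piFinSuccAbove (fun _ : Fin (n + 1) => ℝ) 0).symm fun x y => ?_
    ext i
    refine Fin.cases ?_ (fun j => ?_) i <;>
      simp [MeasurableEquiv.piFinSuccAbove]

/-- The Prékopa–Leindler inequality for midpoints in Euclidean space. -/
theorem hasPrekopaLeindler_euclideanSpace (n : ℕ) :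
    HasPrekopaLeindler (EuclideanSpace ℝ (Fin n)) :=
  (hasPrekopaLeindler_pi n).of_measurePreserving (PiLp.volume_preserving_toLp (Fin n))
    fun _ _ => rfl

/-- The lower bound for the Wills functional. -/
theorem rpow_half_le_wills {n : ℕ} {K : Set (EuclideanSpace ℝ (Fin n))} (hK : Convex ℝ K)
    (hKc : IsCompact K) (hKn : K.Nonempty) :
    ((8 : ℝ) ^ ((n : ℝ) / 2) * volume.real K) ^ ((1 : ℝ) / 2) ≤ wills K := by
  obtain ⟨hw0, hw⟩ := genWills_sqProfile hK hKc hKn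
  have hp := Real.pi_pos
  set D : EuclideanSpace ℝ (Fin n) → ℝ≥0∞ := fun z =>
    ENNReal.ofReal (Real.exp (-(Real.pi * Metric.infDist z K ^ 2))) with hD
  have hDm : Measurable D := by
    have h := (Metric.continuous_infDist_pt K).measurable
    fun_prop
  have hDint : ∫⁻ z, D z = ENNReal.ofReal (wills K) := by
    rw [← hw, genWills]
    refine lintegral_congr fun z => ?_
    rw [relDist_unitBall hKc hKn, sqProfile, ← EReal.coe_neg, EReal.exp_coe]
  -- At the midpoint of `a` and `b` the third function is `D (a + b)`. For `a ∈ K` its square is at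
  -- least `exp (-2π‖b‖²)`, since `a + b` is within `‖b‖` of `K`.
  have hPL := hasPrekopaLeindler_euclideanSpace n (K.indicator 1)
    (fun b => ENNReal.ofReal (Real.exp (-(2 * Real.pi) * ‖b‖ ^ 2))) (fun z => D ((2 : ℝ) • z))
    (measurable_one.indicator hKc.measurableSet) (by fun_prop)
    (hDm.comp (measurable_const_smul _)) (fun a b => by
      by_cases ha : a ∈ K
      · rw [indicator_of_mem ha, Pi.one_apply, one_mul, hD,
          ← ENNReal.ofReal_pow (Real.exp_pos _).le, ← Real.exp_nat_mul]
        refine ENNReal.ofReal_le_ofReal (Real.exp_le_exp.2 ?_)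
        have h1 : (2 : ℝ) • ((1 / 2 : ℝ) • a + (1 / 2 : ℝ) • b) = a + b := by module
        have h2 : Metric.infDist (a + b) K ≤ ‖b‖ := by
          have := Metric.infDist_le_dist_of_mem (x := a + b) ha
          rwa [dist_eq_norm, add_sub_cancel_left] at this
        have h3 : Metric.infDist (a + b) K ^ 2 ≤ ‖b‖ ^ 2 := by
          have := Metric.infDist_nonneg (x := a + b) (s := K)
          gcongr
        rw [h1]
        push_cast
        nlinarith
      · rw [indicator_of_notMem ha, zero_mul]; exact zero_le)
  rw [lintegral_indicator_one hKc.measurableSet, lintegral_exp_neg_mul_norm_sq (by positivity),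
    lintegral_comp_smul D two_pos, hDint, div_mul_cancel_right₀ Real.pi_ne_zero, ← one_div] at hPL
  have h := ENNReal.toReal_mono (by finiteness) hPL
  rw [ENNReal.toReal_mul, ENNReal.toReal_pow, ENNReal.toReal_mul,
    ENNReal.toReal_ofReal (by positivity), ENNReal.toReal_ofReal (by positivity),
    ENNReal.toReal_ofReal hw0, ← measureReal_def] at h
  rw [← Real.sqrt_eq_rpow]
  refine Real.sqrt_le_iff.2 ⟨hw0, ?_⟩
  rw [← four_pow_mul_half_rpow]
  have h4 : ((2 : ℝ) ^ n)⁻¹ ^ 2 * 4 ^ n = 1 := by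
    rw [show (4 : ℝ) = 2 ^ 2 by norm_num, ← pow_mul, mul_comm 2 n, pow_mul, ← mul_pow,
      inv_mul_cancel₀ (by positivity), one_pow]
  calc (4 : ℝ) ^ n * (1 / 2) ^ ((n : ℝ) / 2) * volume.real K
      = 4 ^ n * (volume.real K * (1 / 2) ^ ((n : ℝ) / 2)) := by ring
    _ ≤ 4 ^ n * (((2 : ℝ) ^ n)⁻¹ * wills K) ^ 2 := by gcongr
    _ = (((2 : ℝ) ^ n)⁻¹ ^ 2 * 4 ^ n) * wills K ^ 2 := by ring
    _ = wills K ^ 2 := by rw [h4, one_mul]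

end PrekopaLeindler

end Wills

/-! ### Assembly of the bounds and the values of the constant. -/

theorem theorem1p2 :
    -- the two bounds for the Wills functional
    (∀ (n : ℕ) (K : ConvexBody (EuclideanSpace ℝ (Fin n))),
      (interior (K : Set (EuclideanSpace ℝ (Fin n)))).Nonempty →
      ((8 : ℝ) ^ ((n : ℝ) / 2) * volume.real (K : Set (EuclideanSpace ℝ (Fin n)))) ^ ((1 : ℝ) / 2)
          ≤ Wills.wills (K : Set (EuclideanSpace ℝ (Fin n))) ∧
      Wills.wills (K : Set (EuclideanSpace ℝ (Fin n)))
          ≤ (8 : ℝ) ^ ((n : ℝ) / 2) * volume.real (K : Set (EuclideanSpace ℝ (Fin n))) /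
            ⨆ y : EuclideanSpace ℝ (Fin n), (Wills.gaussian n).real
              ({y} + Real.sqrt (2 * Real.pi) • (K : Set (EuclideanSpace ℝ (Fin n))))) ∧
    -- the upper bound for the generalized Wills functional
    (∀ (n : ℕ) (K E : ConvexBody (EuclideanSpace ℝ (Fin n))) (u : ℝ → EReal),
      (interior (K : Set (EuclideanSpace ℝ (Fin n)))).Nonempty →
      (0 : EuclideanSpace ℝ (Fin n)) ∈ interior (E : Set (EuclideanSpace ℝ (Fin n))) →
      Wills.IsConvexIncreasing u → Wills.IsStrictlyIncreasing u →
      Wills.genWills u (K : Set (EuclideanSpace ℝ (Fin n))) (E : Set (EuclideanSpace ℝ (Fin n)))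
        ≤ min (((2 * n).choose n : ℝ≥0∞) * EReal.exp (-u 0) * Wills.moment u n)
              ((4 : ℝ≥0∞) ^ n * Wills.moment (fun t => 2 * u t) n) *
            (volume (K : Set (EuclideanSpace ℝ (Fin n))) *
              volume (E : Set (EuclideanSpace ℝ (Fin n)))) /
          ⨆ y : EuclideanSpace ℝ (Fin n),
            Wills.gaugeMeasure u (E : Set (EuclideanSpace ℝ (Fin n)))
              ({y} - (K : Set (EuclideanSpace ℝ (Fin n))))) ∧
    -- its classical case, with the improved constant
    (∀ (n : ℕ) (K : ConvexBody (EuclideanSpace ℝ (Fin n))),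
      (interior (K : Set (EuclideanSpace ℝ (Fin n)))).Nonempty →
      Wills.wills (K : Set (EuclideanSpace ℝ (Fin n)))
        ≤ min ((2 * n).choose n : ℝ) ((8 : ℝ) ^ ((n : ℝ) / 2)) *
            volume.real (K : Set (EuclideanSpace ℝ (Fin n))) /
          ⨆ y : EuclideanSpace ℝ (Fin n), (Wills.gaussian n).real
            ({y} + Real.sqrt (2 * Real.pi) • (K : Set (EuclideanSpace ℝ (Fin n))))) ∧
    -- the value of the constant
    (min ((2 * 2).choose 2 : ℝ) ((8 : ℝ) ^ ((2 : ℝ) / 2)) = 6 ∧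
      min ((2 * 3).choose 3 : ℝ) ((8 : ℝ) ^ ((3 : ℝ) / 2)) = 20 ∧
      ∀ n : ℕ, 4 ≤ n →
        min ((2 * n).choose n : ℝ) ((8 : ℝ) ^ ((n : ℝ) / 2)) = (8 : ℝ) ^ ((n : ℝ) / 2)) := by
  refine ⟨fun n K hK => ⟨?_, ?_⟩, fun n K E u hK hE hu hs => ?_, fun n K hK => ?_, ?_, ?_, ?_⟩
  · exact Wills.rpow_half_le_wills K.convex K.isCompact K.nonempty
  · exact Wills.wills_le_div_iSup K.convex K.isCompact hK fun y =>
      (Wills.wills_mul_gaussian_le K.convex K.isCompact K.nonempty y).2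
  · exact Wills.genWills_le hu hs K.convex K.isCompact hK E.convex hE E.isCompact
  · refine Wills.wills_le_div_iSup K.convex K.isCompact hK fun y => ?_
    have h := Wills.wills_mul_gaussian_le K.convex K.isCompact K.nonempty y
    rcases min_choice ((2 * n).choose n : ℝ) ((8 : ℝ) ^ ((n : ℝ) / 2)) with hm | hm
    · rw [hm]; exact h.1
    · rw [hm]; exact h.2
  · norm_num [Nat.choose]
  · have h : (20 : ℝ) ≤ (8 : ℝ) ^ ((3 : ℝ) / 2) := by
      rw [show (3 : ℝ) / 2 = (3 : ℕ) * (1 / 2 : ℝ) by norm_num, Real.rpow_mul (by norm_num),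
        Real.rpow_natCast, ← Real.sqrt_eq_rpow]
      exact Real.le_sqrt_of_sq_le (by norm_num)
    rw [show (2 * 3 : ℕ).choose 3 = 20 from rfl, min_eq_left (by exact_mod_cast h)]
    norm_num
  · exact fun n hn => min_eq_right (Wills.eight_rpow_half_le_choose hn)
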